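/- Let $L>0$ and let $X_0=[L^2(0,L)]^2$ be the Hilbert space (over $\mathbb{R}$ or over $\mathbb{C}$) of pairs of square-integrable scalar functions on $(0,L)$, with inner product $((\eta,w),(\theta,u))_{X_0}=\int_0^L(\eta\overline{\theta}+w\overline{u})\,dx$. Let $A$ be the unbounded operator in $X_0$ given by $$A(\eta,w)=(-w'-w''',\,-\eta'-\eta'''),$$ $$D(A)=\{(\eta,w)\in[H^3(0,L)\cap H^1_0(0,L)]^2:\ \eta'(0)=w'(L)=0\}.$$ Then $A$ is skew-adjoint in $X_0$, that is, $D(A)$ is dense in $X_0$ and $A^*=-A$ (including $D(A^*)=D(A)$). Moreover, $A$ is the infinitesimal generator of a strongly continuous one-parameter group $(e^{tA})_{t\in\mathbb{R}}$ of bounded linear operators on $X_0$, and $e^{tA}$ is an isometry of $X_0$ for every $t\in\mathbb{R}$. -/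

import Mathlib

open MeasureTheory Filter Topology
open scoped ContDiff LinearPMap

namespace Boussinesq

/-- The space `L²(0,L)` of `𝕜`-valued functions. -/
abbrev L2 (𝕜 : Type*) [RCLike 𝕜] (L : ℝ) : Type _ :=
  Lp 𝕜 2 (volume.restrict (Set.Ioo (0 : ℝ) L))

/-- The Hilbert space `X₀ = L²(0,L)²`, with inner product
`⟪(η,w),(θ,u)⟫ = ⟪η,θ⟫ + ⟪w,u⟫`. -/
abbrev X0 (𝕜 : Type*) [RCLike 𝕜] (L : ℝ) : Type _ :=
  WithLp 2 (L2 𝕜 L × L2 𝕜 L)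

/-- `φ ∈ C_c^∞(0,L)` (extended by zero to `ℝ`), with values in a real normed space. -/
structure IsTest {E : Type*} [NormedAddCommGroup E] [NormedSpace ℝ E]
    (L : ℝ) (φ : ℝ → E) : Prop where
  smooth : ContDiff ℝ ∞ φ
  compact : HasCompactSupport φ
  supp : tsupport φ ⊆ Set.Ioo 0 L

section

variable {𝕜 : Type*} [RCLike 𝕜] {L : ℝ}

/-- `g` is the `n`-th weak derivative of `f` on `(0,L)`. -/
def IsWeakDeriv (n : ℕ) (f g : L2 𝕜 L) : Prop :=
  ∀ φ : ℝ → ℝ, IsTest L φ →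
    ∫ x in Set.Ioo 0 L, iteratedDeriv n φ x • f x =
      (-1 : ℝ) ^ n • ∫ x in Set.Ioo 0 L, φ x • g x

theorem IsTest.iteratedDeriv_continuous {φ : ℝ → ℝ} (hφ : IsTest L φ) (n : ℕ) :
    Continuous (iteratedDeriv n φ) :=
  hφ.smooth.continuous_iteratedDeriv n (by exact_mod_cast le_top)

theorem IsTest.iteratedDeriv_hasCompactSupport {φ : ℝ → ℝ} (hφ : IsTest L φ) (n : ℕ) :
    HasCompactSupport (iteratedDeriv n φ) := by
  induction n with
  | zero => simpa using hφ.compact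
  | succ n ih => rw [iteratedDeriv_succ]; exact ih.deriv

theorem IsTest.integrable {φ : ℝ → ℝ} (hφ : IsTest L φ) (n : ℕ) (f : L2 𝕜 L) :
    Integrable (fun x => iteratedDeriv n φ x • f x) (volume.restrict (Set.Ioo 0 L)) := by
  have hf : Integrable (fun x => f x) (volume.restrict (Set.Ioo 0 L)) :=
    (Lp.memLp f).integrable (by norm_num)
  obtain ⟨C, hC⟩ := (hφ.iteratedDeriv_hasCompactSupport n).exists_bound_of_continuous
    (hφ.iteratedDeriv_continuous n)
  exact hf.bdd_smul C (hφ.iteratedDeriv_continuous n).aestronglyMeasurable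
    (Eventually.of_forall hC)

theorem IsTest.integrable_zero {φ : ℝ → ℝ} (hφ : IsTest L φ) (f : L2 𝕜 L) :
    Integrable (fun x => φ x • f x) (volume.restrict (Set.Ioo 0 L)) := by
  simpa using hφ.integrable 0 f

theorem IsWeakDeriv.zero (n : ℕ) : IsWeakDeriv n (0 : L2 𝕜 L) 0 := by
  intro φ hφ
  have h0 : ∀ u : ℝ → ℝ, ∫ x in Set.Ioo 0 L, u x • (0 : L2 𝕜 L) x = 0 := by
    intro u
    refine integral_eq_zero_of_ae ?_
    filter_upwards [Lp.coeFn_zero 𝕜 2 (volume.restrict (Set.Ioo 0 L))] with x hx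
    rw [hx]; simp
  rw [h0, h0, smul_zero]

theorem IsWeakDeriv.add {n : ℕ} {f g f' g' : L2 𝕜 L} (h : IsWeakDeriv n f f')
    (k : IsWeakDeriv n g g') : IsWeakDeriv n (f + g) (f' + g') := by
  intro φ hφ
  have h1 : ∀ u : ℝ → ℝ, ∀ a b : L2 𝕜 L,
      ∫ x in Set.Ioo 0 L, u x • (a + b) x = ∫ x in Set.Ioo 0 L, (u x • a x + u x • b x) := by
    intro u a b
    refine integral_congr_ae ?_
    filter_upwards [Lp.coeFn_add a b] with x hx
    rw [hx, Pi.add_apply, smul_add]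
  rw [h1, h1, integral_add (hφ.integrable n f) (hφ.integrable n g),
    integral_add (hφ.integrable_zero f') (hφ.integrable_zero g'), h φ hφ, k φ hφ, smul_add]

theorem IsWeakDeriv.smul {n : ℕ} {f f' : L2 𝕜 L} (c : 𝕜) (h : IsWeakDeriv n f f') :
    IsWeakDeriv n (c • f) (c • f') := by
  intro φ hφ
  have h1 : ∀ u : ℝ → ℝ, ∀ a : L2 𝕜 L,
      ∫ x in Set.Ioo 0 L, u x • (c • a) x = c • ∫ x in Set.Ioo 0 L, u x • a x := by
    intro u a
    rw [← integral_smul]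
    refine integral_congr_ae ?_
    filter_upwards [Lp.coeFn_smul c a] with x hx
    rw [hx, Pi.smul_apply, smul_comm]
  rw [h1, h1, h φ hφ, smul_comm]

theorem IsWeakDeriv.unique {n : ℕ} {f g g' : L2 𝕜 L} (h : IsWeakDeriv n f g)
    (h' : IsWeakDeriv n f g') : g = g' := by
  have hd : IsWeakDeriv n (0 : L2 𝕜 L) (g - g') := by
    have := h.add (h'.smul (-1))
    simpa [sub_eq_add_neg] using this
  have key : ∀ᵐ x, x ∈ Set.Ioo 0 L → (g - g' : L2 𝕜 L) x = 0 := by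
    refine isOpen_Ioo.ae_eq_zero_of_integral_contDiff_smul_eq_zero ?_ ?_
    · exact IntegrableOn.locallyIntegrableOn
        ((Lp.memLp (g - g')).integrable (by norm_num))
    · intro φ h1 h2 h3
      have hφ : IsTest L φ := ⟨h1, h2, h3⟩
      have e := hd φ hφ
      have e0 : ∫ x in Set.Ioo 0 L, iteratedDeriv n φ x • (0 : L2 𝕜 L) x = 0 := by
        refine integral_eq_zero_of_ae ?_
        filter_upwards [Lp.coeFn_zero 𝕜 2 (volume.restrict (Set.Ioo 0 L))] with x hx
        rw [hx]; simp
      rw [e0] at e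
      have e1 : ∫ x in Set.Ioo 0 L, φ x • (g - g' : L2 𝕜 L) x = 0 :=
        (smul_eq_zero.mp e.symm).resolve_left (pow_ne_zero _ (by norm_num))
      rw [← e1]
      refine (setIntegral_eq_integral_of_forall_compl_eq_zero ?_).symm
      intro x hx
      rw [image_eq_zero_of_notMem_tsupport (fun hx' => hx (h3 hx')), zero_smul]
  have : (g - g' : L2 𝕜 L) = 0 := by
    rw [Lp.eq_zero_iff_ae_eq_zero]
    exact (ae_restrict_iff' measurableSet_Ioo).2 key
  exact sub_eq_zero.mp this

open Classical in
/-- The `n`-th weak derivative of `f` on `(0,L)` (it is unique; `0` if there is none in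
`L²(0,L)`). -/
noncomputable def weakDeriv (n : ℕ) (f : L2 𝕜 L) : L2 𝕜 L :=
  if h : ∃ g, IsWeakDeriv n f g then h.choose else 0

theorem isWeakDeriv_weakDeriv {n : ℕ} {f : L2 𝕜 L} (h : ∃ g, IsWeakDeriv n f g) :
    IsWeakDeriv n f (weakDeriv n f) := by
  rw [weakDeriv, dif_pos h]; exact h.choose_spec

theorem IsWeakDeriv.weakDeriv_eq {n : ℕ} {f g : L2 𝕜 L} (h : IsWeakDeriv n f g) :
    weakDeriv n f = g :=
  (isWeakDeriv_weakDeriv ⟨g, h⟩).unique h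

variable (𝕜 L) in
/-- The Sobolev space `H^k(0,L)`: all weak derivatives up to order `k` exist in `L²(0,L)`. -/
noncomputable def sobolevH (k : ℕ) : Submodule 𝕜 (L2 𝕜 L) where
  carrier := {f | ∀ j ≤ k, ∃ g, IsWeakDeriv j f g}
  zero_mem' := fun j _ => ⟨0, IsWeakDeriv.zero j⟩
  add_mem' := fun ha hb j hj =>
    let ⟨_, hu⟩ := ha j hj
    let ⟨_, hv⟩ := hb j hj
    ⟨_, hu.add hv⟩
  smul_mem' := fun c _ ha j hj => let ⟨_, hu⟩ := ha j hj; ⟨_, hu.smul c⟩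

theorem weakDeriv_zero (n : ℕ) : weakDeriv n (0 : L2 𝕜 L) = 0 :=
  (IsWeakDeriv.zero n).weakDeriv_eq

theorem weakDeriv_add {n k : ℕ} (hn : n ≤ k) {f g : L2 𝕜 L} (hf : f ∈ sobolevH 𝕜 L k)
    (hg : g ∈ sobolevH 𝕜 L k) : weakDeriv n (f + g) = weakDeriv n f + weakDeriv n g :=
  ((isWeakDeriv_weakDeriv (hf n hn)).add (isWeakDeriv_weakDeriv (hg n hn))).weakDeriv_eq

theorem weakDeriv_smul {n k : ℕ} (hn : n ≤ k) (c : 𝕜) {f : L2 𝕜 L}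
    (hf : f ∈ sobolevH 𝕜 L k) : weakDeriv n (c • f) = c • weakDeriv n f :=
  ((isWeakDeriv_weakDeriv (hf n hn)).smul c).weakDeriv_eq

/-- `f` is the limit in `H¹(0,L)` of a sequence in `C_c^∞(0,L)`. -/
def IsH1LimitOfTest (f : L2 𝕜 L) : Prop :=
  ∃ φ : ℕ → ℝ → 𝕜, (∀ n, IsTest L (φ n)) ∧
    Tendsto (fun n => eLpNorm (fun x => φ n x - f x) 2 (volume.restrict (Set.Ioo 0 L)))
      atTop (𝓝 0) ∧
    Tendsto (fun n => eLpNorm (fun x => deriv (φ n) x - weakDeriv 1 f x) 2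
      (volume.restrict (Set.Ioo 0 L))) atTop (𝓝 0)

theorem IsTest.add {E : Type*} [NormedAddCommGroup E] [NormedSpace ℝ E] {φ ψ : ℝ → E}
    (hφ : IsTest L φ) (hψ : IsTest L ψ) : IsTest L (φ + ψ) :=
  ⟨hφ.smooth.add hψ.smooth, hφ.compact.add hψ.compact,
    (tsupport_add φ ψ).trans (Set.union_subset hφ.supp hψ.supp)⟩

theorem IsTest.smul {φ : ℝ → 𝕜} (c : 𝕜) (hφ : IsTest L φ) : IsTest L (c • φ) :=
  ⟨hφ.smooth.const_smul c, hφ.compact.mono' ((Function.support_const_smul_subset c φ).trans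
    subset_closure), (closure_mono (Function.support_const_smul_subset c φ)).trans hφ.supp⟩

theorem tendsto_eLpNorm_add {μ : Measure ℝ} {a b : ℕ → ℝ → 𝕜} {f g h : ℝ → 𝕜}
    (ha : ∀ n, AEStronglyMeasurable (fun x => a n x - f x) μ)
    (hb : ∀ n, AEStronglyMeasurable (fun x => b n x - g x) μ)
    (hh : h =ᵐ[μ] f + g)
    (h1 : Tendsto (fun n => eLpNorm (fun x => a n x - f x) 2 μ) atTop (𝓝 0))
    (h2 : Tendsto (fun n => eLpNorm (fun x => b n x - g x) 2 μ) atTop (𝓝 0)) :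
    Tendsto (fun n => eLpNorm (fun x => (a n x + b n x) - h x) 2 μ) atTop (𝓝 0) := by
  have h12 := h1.add h2
  rw [add_zero] at h12
  refine tendsto_of_tendsto_of_tendsto_of_le_of_le tendsto_const_nhds h12
    (fun _ => bot_le) (fun n => ?_)
  refine le_trans (le_of_eq (eLpNorm_congr_ae ?_)) (eLpNorm_add_le (ha n) (hb n) (by norm_num))
  filter_upwards [hh] with x hx
  simp only [hx, Pi.add_apply]
  ring

theorem tendsto_eLpNorm_smul {μ : Measure ℝ} {a : ℕ → ℝ → 𝕜} {f h : ℝ → 𝕜} (c : 𝕜)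
    (hh : h =ᵐ[μ] c • f)
    (h1 : Tendsto (fun n => eLpNorm (fun x => a n x - f x) 2 μ) atTop (𝓝 0)) :
    Tendsto (fun n => eLpNorm (fun x => (c • a n x) - h x) 2 μ) atTop (𝓝 0) := by
  have h2 := ENNReal.Tendsto.const_mul (a := ‖c‖ₑ) h1 (Or.inr enorm_ne_top)
  rw [mul_zero] at h2
  refine h2.congr (fun n => ?_)
  rw [← eLpNorm_const_smul]
  refine eLpNorm_congr_ae ?_
  filter_upwards [hh] with x hx
  simp only [hx, Pi.smul_apply, smul_eq_mul]
  ring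

theorem IsTest.sub_aesm {φ : ℝ → 𝕜} (hφ : IsTest L φ) (f : L2 𝕜 L) :
    AEStronglyMeasurable (fun x => φ x - f x) (volume.restrict (Set.Ioo 0 L)) :=
  hφ.smooth.continuous.aestronglyMeasurable.sub (Lp.aestronglyMeasurable f)

theorem IsTest.deriv_sub_aesm {φ : ℝ → 𝕜} (hφ : IsTest L φ) (f : L2 𝕜 L) :
    AEStronglyMeasurable (fun x => deriv φ x - f x) (volume.restrict (Set.Ioo 0 L)) :=
  (hφ.smooth.continuous_deriv (by exact_mod_cast le_top)).aestronglyMeasurable.sub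
    (Lp.aestronglyMeasurable f)

theorem IsTest.differentiable {φ : ℝ → 𝕜} (hφ : IsTest L φ) : Differentiable ℝ φ :=
  hφ.smooth.differentiable (by simp)

variable (𝕜 L) in
/-- The Sobolev space `H¹₀(0,L)`: the closure of `C_c^∞(0,L)` in `H¹(0,L)`. -/
noncomputable def sobolevH10 : Submodule 𝕜 (L2 𝕜 L) where
  carrier := {f | f ∈ sobolevH 𝕜 L 1 ∧ IsH1LimitOfTest f}
  zero_mem' := by
    refine ⟨zero_mem _, fun _ => 0, fun _ => ⟨contDiff_const, HasCompactSupport.zero, ?_⟩, ?_, ?_⟩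
    · simp [tsupport]
    · refine tendsto_const_nhds.congr (fun n => ?_)
      rw [← eLpNorm_zero (α := ℝ) (ε := 𝕜) (p := 2) (μ := volume.restrict (Set.Ioo 0 L))]
      refine eLpNorm_congr_ae ?_
      filter_upwards [Lp.coeFn_zero 𝕜 2 (volume.restrict (Set.Ioo 0 L))] with x hx
      rw [hx]; simp
    · rw [weakDeriv_zero]
      refine tendsto_const_nhds.congr (fun n => ?_)
      rw [← eLpNorm_zero (α := ℝ) (ε := 𝕜) (p := 2) (μ := volume.restrict (Set.Ioo 0 L))]
      refine eLpNorm_congr_ae ?_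
      filter_upwards [Lp.coeFn_zero 𝕜 2 (volume.restrict (Set.Ioo 0 L))] with x hx
      have : deriv (0 : ℝ → 𝕜) x = 0 := by
        rw [Pi.zero_def]; exact deriv_const x (0 : 𝕜)
      rw [hx, this]; simp
  add_mem' := by
    rintro f g ⟨hf, φ, tφ, f0, f1⟩ ⟨hg, ψ, tψ, g0, g1⟩
    refine ⟨add_mem hf hg, fun n => φ n + ψ n, fun n => (tφ n).add (tψ n), ?_, ?_⟩
    · exact tendsto_eLpNorm_add (fun n => (tφ n).sub_aesm f) (fun n => (tψ n).sub_aesm g)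
        (Lp.coeFn_add f g) f0 g0
    · have := tendsto_eLpNorm_add (fun n => (tφ n).deriv_sub_aesm (weakDeriv 1 f))
        (fun n => (tψ n).deriv_sub_aesm (weakDeriv 1 g)) (Lp.coeFn_add _ _) f1 g1
      rw [weakDeriv_add le_rfl hf hg]
      refine this.congr (fun n => ?_)
      congr 1
      funext x
      rw [deriv_add ((tφ n).differentiable x) ((tψ n).differentiable x)]
  smul_mem' := by
    rintro c f ⟨hf, φ, tφ, f0, f1⟩
    refine ⟨Submodule.smul_mem _ c hf, fun n => c • φ n, fun n => (tφ n).smul c, ?_, ?_⟩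
    · exact tendsto_eLpNorm_smul c (Lp.coeFn_smul c f) f0
    · have := tendsto_eLpNorm_smul c (Lp.coeFn_smul c (weakDeriv 1 f)) f1
      rw [weakDeriv_smul le_rfl c hf]
      refine this.congr (fun n => ?_)
      congr 1
      funext x
      rw [deriv_const_smul c ((tφ n).differentiable x)]

/-- `f` has a representative that is continuous on `[0,L]` and takes the value `c` at the
point `a ∈ [0,L]`; for `f ∈ H¹(0,L)` this says that `f(a) = c`. -/
def HasTrace (f : L2 𝕜 L) (a : ℝ) (c : 𝕜) : Prop :=
  ∃ F : ℝ → 𝕜, ContinuousOn F (Set.Icc 0 L) ∧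
    f =ᵐ[volume.restrict (Set.Ioo 0 L)] F ∧ F a = c

theorem HasTrace.zero (a : ℝ) : HasTrace (0 : L2 𝕜 L) a 0 :=
  ⟨0, continuousOn_const, Lp.coeFn_zero _ _ _, rfl⟩

theorem HasTrace.add {f g : L2 𝕜 L} {a : ℝ} {c d : 𝕜} (h : HasTrace f a c)
    (k : HasTrace g a d) : HasTrace (f + g) a (c + d) := by
  obtain ⟨F, hF, hfF, rfl⟩ := h
  obtain ⟨G, hG, hgG, rfl⟩ := k
  exact ⟨F + G, hF.add hG, (Lp.coeFn_add f g).trans (hfF.add hgG), rfl⟩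

theorem HasTrace.smul {f : L2 𝕜 L} {a : ℝ} {c : 𝕜} (r : 𝕜) (h : HasTrace f a c) :
    HasTrace (r • f) a (r • c) := by
  obtain ⟨F, hF, hfF, rfl⟩ := h
  exact ⟨r • F, hF.const_smul r, (Lp.coeFn_smul r f).trans (hfF.const_smul r), rfl⟩

variable (𝕜 L) in
/-- `D(A) = {(η,w) ∈ [H³(0,L) ∩ H¹₀(0,L)]² : η'(0) = w'(L) = 0}`. -/
noncomputable def domainA : Submodule 𝕜 (X0 𝕜 L) where
  carrier := {z | z.fst ∈ sobolevH 𝕜 L 3 ⊓ sobolevH10 𝕜 L ∧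
    z.snd ∈ sobolevH 𝕜 L 3 ⊓ sobolevH10 𝕜 L ∧
    HasTrace (weakDeriv 1 z.fst) 0 0 ∧ HasTrace (weakDeriv 1 z.snd) L 0}
  zero_mem' := by
    refine ⟨zero_mem _, zero_mem _, ?_, ?_⟩
    · rw [WithLp.zero_fst, weakDeriv_zero]; exact HasTrace.zero 0
    · rw [WithLp.zero_snd, weakDeriv_zero]; exact HasTrace.zero L
  add_mem' := by
    rintro z z' ⟨h1, h2, h3, h4⟩ ⟨k1, k2, k3, k4⟩
    refine ⟨add_mem h1 k1, add_mem h2 k2, ?_, ?_⟩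
    · rw [WithLp.add_fst, weakDeriv_add (by norm_num) h1.1 k1.1]
      simpa using h3.add k3
    · rw [WithLp.add_snd, weakDeriv_add (by norm_num) h2.1 k2.1]
      simpa using h4.add k4
  smul_mem' := by
    rintro c z ⟨h1, h2, h3, h4⟩
    refine ⟨Submodule.smul_mem _ c h1, Submodule.smul_mem _ c h2, ?_, ?_⟩
    · rw [WithLp.smul_fst, weakDeriv_smul (by norm_num) c h1.1]
      simpa using h3.smul c
    · rw [WithLp.smul_snd, weakDeriv_smul (by norm_num) c h2.1]
      simpa using h4.smul c

variable (𝕜 L) in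
/-- The operator `A(η,w) = (-w' - w''', -η' - η''')` in `X₀`, with domain `D(A)`. -/
noncomputable def opA : X0 𝕜 L →ₗ.[𝕜] X0 𝕜 L where
  domain := domainA 𝕜 L
  toFun :=
    { toFun := fun z => WithLp.toLp 2
        (-weakDeriv 1 (z : X0 𝕜 L).snd - weakDeriv 3 (z : X0 𝕜 L).snd,
          -weakDeriv 1 (z : X0 𝕜 L).fst - weakDeriv 3 (z : X0 𝕜 L).fst)
      map_add' := by
        rintro ⟨z, h1, h2, h3, h4⟩ ⟨z', k1, k2, k3, k4⟩
        rw [← WithLp.toLp_add]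
        simp only [Submodule.coe_add, WithLp.add_fst, WithLp.add_snd, Prod.mk_add_mk,
          weakDeriv_add (show 1 ≤ 3 by norm_num) h1.1 k1.1,
          weakDeriv_add (show 3 ≤ 3 by norm_num) h1.1 k1.1,
          weakDeriv_add (show 1 ≤ 3 by norm_num) h2.1 k2.1,
          weakDeriv_add (show 3 ≤ 3 by norm_num) h2.1 k2.1]
        congr 2 <;> abel
      map_smul' := by
        rintro c ⟨z, h1, h2, h3, h4⟩
        rw [← WithLp.toLp_smul]
        simp only [SetLike.val_smul, WithLp.smul_fst, WithLp.smul_snd, Prod.smul_mk,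
          RingHom.id_apply,
          weakDeriv_smul (show 1 ≤ 3 by norm_num) c h1.1,
          weakDeriv_smul (show 3 ≤ 3 by norm_num) c h1.1,
          weakDeriv_smul (show 1 ≤ 3 by norm_num) c h2.1,
          weakDeriv_smul (show 3 ≤ 3 by norm_num) c h2.1, smul_sub, smul_neg] }

end

section

variable {𝕜 X : Type*} [RCLike 𝕜] [NormedAddCommGroup X] [InnerProductSpace 𝕜 X]

/-- A densely defined operator `A` is skew-adjoint if `A* = -A` (equality of domains included). -/
def IsSkewAdjoint [CompleteSpace X] (A : X →ₗ.[𝕜] X) : Prop :=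
  Dense (A.domain : Set X) ∧ A† = -A

/-- A strongly continuous one-parameter group of bounded operators. -/
structure IsC0Group (U : ℝ → X →L[𝕜] X) : Prop where
  map_zero : U 0 = ContinuousLinearMap.id 𝕜 X
  map_add : ∀ s t, U (s + t) = (U s).comp (U t)
  strongly_continuous : ∀ x, Continuous fun t => U t x

/-- `A` is the infinitesimal generator of `U`: `x ∈ D(A)` and `A x = y` if and only if
`(U t x - x) / t → y` as `t → 0`. -/
def IsGenerator (A : X →ₗ.[𝕜] X) (U : ℝ → X →L[𝕜] X) : Prop :=
  ∀ x y : X, (∃ hx : x ∈ A.domain, A ⟨x, hx⟩ = y) ↔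
    Tendsto (fun t : ℝ => ((t⁻¹ : ℝ) : 𝕜) • (U t x - x)) (𝓝[≠] 0) (𝓝 y)

end

end Boussinesq

/-! Write `T f = f' + f'''`, so that `A(η,w) = (-T w, -T η)`, and let `D_a` be the set of `f` in `H³
∩ H¹₀` with `f'(a) = 0`. Then `D(A) = D_0 × D_L`, and both components are handled by one argument
with `a`, `b` the two ends in either order.

Skew-symmetry: integrating by parts, `⟪T u, v⟫ + ⟪u, T v⟫` equals a boundary form. If `u` and `v`
vanish at both ends, only the product of the first derivatives survives, and for `u ∈ D_a`, `v ∈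
D_b` one factor is zero at each end.

Maximality (`AreEnds.isDom_of_forall`): suppose `⟪T w, θ⟫ = -⟪w, q⟫` for all `w ∈ D_b`. Let `f`
solve `T f = q` with zero data at `a`, and let `e(x) = 1 - cos(x - a)`, so that `T e = 0` and `e(a)
= e'(a) = 0`. For `g ⟂ e`, the solution of `T w = g` with zero data at `b` also vanishes at `a`, by
variation of constants, so it lies in `D_b`. Hence `θ - f` is orthogonal to `e^⟂`, and `θ = f + c e`
is in `H³` with `θ(a) = θ'(a) = 0`. Testing with one cubic of `D_b` gives `θ(b) = 0`. No length `L`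
is exceptional. The passage from weak derivatives and `H¹₀` to boundary values rests on the du
Bois-Reymond lemma.

The group comes from Stone's theorem, proved over `ℝ` and `ℂ` at once without spectral theory.
Skew-adjointness makes `1 + εA` bijective with contractive inverse for `ε ≠ 0`. The operators `A(1 -
ε²A²)⁻¹` are bounded, skew-adjoint, commute, and tend to `A` on `D(A)`. Their exponentials are
isometries whose distance at `x ∈ D(A)` is controlled by that of the operators, so they converge to
the required group. -/

namespace Boussinesq

/-! ### Exponentials of bounded skew-adjoint operators and their strong limits -/

section BoundedGroup

variable {𝕜 X : Type*} [RCLike 𝕜] [NormedAddCommGroup X] [InnerProductSpace 𝕜 X]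

/-- The group `t ↦ e^{tC}` generated by a bounded operator. -/
noncomputable def expGroup (C : X →L[𝕜] X) (t : ℝ) : X →L[𝕜] X :=
  NormedSpace.exp ((t : 𝕜) • C)

theorem expGroup_zero (C : X →L[𝕜] X) : expGroup C 0 = 1 := by
  let _ : NormedAlgebra ℚ (X →L[𝕜] X) := NormedAlgebra.restrictScalars ℚ 𝕜 _
  simp [expGroup]

variable [CompleteSpace X]

theorem expGroup_add (C : X →L[𝕜] X) (s t : ℝ) :
    expGroup C (s + t) = expGroup C s * expGroup C t := by
  let _ : NormedAlgebra ℚ (X →L[𝕜] X) := NormedAlgebra.restrictScalars ℚ 𝕜 _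
  rw [expGroup, expGroup, expGroup, ← NormedSpace.exp_add_of_commute]
  · push_cast; rw [add_smul]
  · exact ((Commute.refl C).smul_left _).smul_right _

theorem expGroup_of_commute {C C' : X →L[𝕜] X} (h : Commute C C') (t : ℝ) :
    expGroup C t = expGroup C' t * expGroup (C - C') t := by
  let _ : NormedAlgebra ℚ (X →L[𝕜] X) := NormedAlgebra.restrictScalars ℚ 𝕜 _
  rw [expGroup, expGroup, expGroup, ← NormedSpace.exp_add_of_commute]
  · rw [← smul_add]; congr 2; abel
  · exact ((h.symm.sub_right (Commute.refl C')).smul_left _).smul_right _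

theorem norm_expGroup_apply {C : X →L[𝕜] X} (hC : C ∈ skewAdjoint (X →L[𝕜] X)) (t : ℝ) (x : X) :
    ‖expGroup C t x‖ = ‖x‖ := by
  let _ : NormedAlgebra ℚ (X →L[𝕜] X) := NormedAlgebra.restrictScalars ℚ 𝕜 _
  have h : (t : 𝕜) • C ∈ skewAdjoint (X →L[𝕜] X) := by
    rw [skewAdjoint.mem_iff] at hC ⊢
    rw [star_smul, hC, smul_neg]; simp
  have hu := NormedSpace.exp_mem_unitary_of_mem_skewAdjoint h
  exact (ContinuousLinearMap.norm_map_iff_adjoint_comp_self _).2 (Unitary.star_mul_self_of_mem hu) x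

variable [NormedSpace ℝ X] [IsScalarTower ℝ 𝕜 X]

theorem hasDerivAt_expGroup_apply (C : X →L[𝕜] X) (t : ℝ) (x : X) :
    HasDerivAt (fun s : ℝ => expGroup C s x) (expGroup C t (C x)) t := by
  have h1 := hasDerivAt_exp_smul_const C (t : 𝕜)
  have h2 : HasDerivAt (fun u : 𝕜 => NormedSpace.exp (u • C) x)
      (expGroup C t (C x)) (t : 𝕜) := by
    have := h1.clm_apply (hasDerivAt_const (t : 𝕜) x)
    simpa [expGroup] using this
  have h3 : HasDerivAt (fun s : ℝ => (s : 𝕜)) 1 t := by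
    simpa using (RCLike.ofRealCLM (K := 𝕜)).hasDerivAt (x := t)
  simpa [expGroup, Function.comp_def] using HasDerivAt.scomp t h2 h3

theorem continuous_expGroup_apply (C : X →L[𝕜] X) (x : X) :
    Continuous fun t => expGroup C t x :=
  continuous_iff_continuousAt.2 fun t => (hasDerivAt_expGroup_apply C t x).continuousAt

/-- The velocity `e^{sC} C x` has constant norm `‖C x‖`, so the mean value inequality applies. -/
theorem norm_expGroup_apply_sub_le {C : X →L[𝕜] X} (hC : C ∈ skewAdjoint (X →L[𝕜] X))
    (t : ℝ) (x : X) : ‖expGroup C t x - x‖ ≤ |t| * ‖C x‖ := by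
  have := (convex_univ (𝕜 := ℝ) (E := ℝ)).norm_image_sub_le_of_norm_hasDerivWithin_le
    (f := fun s => expGroup C s x) (f' := fun s => expGroup C s (C x)) (C := ‖C x‖)
    (fun s _ => (hasDerivAt_expGroup_apply C s x).hasDerivWithinAt)
    (fun s _ => (norm_expGroup_apply hC s _).le) (Set.mem_univ 0) (Set.mem_univ t)
  simpa [expGroup_zero, mul_comm] using this

theorem expGroup_apply_sub_eq_integral (C : X →L[𝕜] X) (t : ℝ) (x : X) :
    expGroup C t x - x = ∫ s in (0 : ℝ)..t, expGroup C s (C x) := by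
  rw [intervalIntegral.integral_eq_sub_of_hasDerivAt
    (fun s _ => hasDerivAt_expGroup_apply C s x)
    ((continuous_expGroup_apply C (C x)).intervalIntegrable _ _), expGroup_zero]
  rfl

/-- By commutation `e^{tC} = e^{tC'} e^{t(C - C')}`. Factoring out the isometry `e^{tC'}` leaves the
displacement of a single group. -/
theorem norm_expGroup_apply_sub_expGroup_apply_le {C C' : X →L[𝕜] X}
    (hC : C ∈ skewAdjoint (X →L[𝕜] X)) (hC' : C' ∈ skewAdjoint (X →L[𝕜] X))
    (h : Commute C C') (t : ℝ) (x : X) :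
    ‖expGroup C t x - expGroup C' t x‖ ≤ |t| * ‖C x - C' x‖ := by
  rw [expGroup_of_commute h, mul_apply_eq_comp, ← map_sub, norm_expGroup_apply hC']
  exact norm_expGroup_apply_sub_le (sub_mem hC hC') t x

/-- Bounded commuting skew-adjoint operators that converge strongly on a dense set generate
groups that converge strongly, to a group of isometries. -/
theorem exists_isometric_group_of_tendsto {B : ℕ → X →L[𝕜] X}
    (hB : ∀ n, B n ∈ skewAdjoint (X →L[𝕜] X)) (hcomm : ∀ m n, Commute (B m) (B n))
    {D : Set X} (hD : Dense D) {a : X → X}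
    (ha : ∀ x ∈ D, Tendsto (fun n => B n x) atTop (𝓝 (a x))) :
    ∃ U : ℝ → X →L[𝕜] X, IsC0Group U ∧ (∀ t x, ‖U t x‖ = ‖x‖) ∧
      ∀ x ∈ D, ∀ t, U t x - x = ∫ s in (0 : ℝ)..t, U s (a x) := by
  have hsub : ∀ n t (x y : X), ‖expGroup (B n) t x - expGroup (B n) t y‖ = ‖x - y‖ := by
    intro n t x y
    rw [← map_sub, norm_expGroup_apply (hB n)]
  have hcau : ∀ t x, CauchySeq fun n => expGroup (B n) t x := by
    intro t x
    rw [Metric.cauchySeq_iff]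
    intro ε hε
    obtain ⟨y, hy, hyD⟩ := Metric.dense_iff.1 hD x (ε / 3) (by positivity)
    have hxy : ‖x - y‖ < ε / 3 := by simpa [dist_eq_norm, norm_sub_rev] using hy
    -- The `+ 1` keeps the denominator positive at `t = 0`.
    obtain ⟨N, hN⟩ := Metric.cauchySeq_iff.1 (ha y hyD).cauchySeq (ε / (3 * (|t| + 1)))
      (by positivity)
    refine ⟨N, fun m hm n hn => ?_⟩
    have h1 : ‖expGroup (B m) t y - expGroup (B n) t y‖ ≤ ε / 3 := by
      refine (norm_expGroup_apply_sub_expGroup_apply_le (hB m) (hB n) (hcomm m n) t y).trans ?_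
      have h2 := (hN m hm n hn).le
      rw [dist_eq_norm] at h2
      calc |t| * ‖B m y - B n y‖ ≤ (|t| + 1) * (ε / (3 * (|t| + 1))) := by
            gcongr; linarith
        _ = ε / 3 := by field_simp
    rw [dist_eq_norm]
    calc ‖expGroup (B m) t x - expGroup (B n) t x‖
        = ‖(expGroup (B m) t x - expGroup (B m) t y) + (expGroup (B m) t y - expGroup (B n) t y)
          - (expGroup (B n) t x - expGroup (B n) t y)‖ := by congr 1; abel
      _ ≤ ‖x - y‖ + ε / 3 + ‖x - y‖ := by
          refine (norm_sub_le _ _).trans (add_le_add ((norm_add_le _ _).trans ?_) (hsub n t x y).le)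
          exact add_le_add (hsub m t x y).le h1
      _ < ε := by linarith
  choose V hV using fun t x => cauchySeq_tendsto_of_complete (hcau t x)
  -- The pointwise limit is a bounded operator by Banach–Steinhaus.
  let U : ℝ → X →L[𝕜] X := fun t =>
    continuousLinearMapOfTendsto (fun n => expGroup (B n) t) (tendsto_pi_nhds.2 (hV t))
  have hU : ∀ t x, Tendsto (fun n => expGroup (B n) t x) atTop (𝓝 (U t x)) := hV
  have hnorm : ∀ t x, ‖U t x‖ = ‖x‖ := fun t x =>
    tendsto_nhds_unique (hU t x).norm
      (by simp only [norm_expGroup_apply (hB _)]; exact tendsto_const_nhds)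
  have hadd : ∀ s t, U (s + t) = (U s).comp (U t) := by
    intro s t
    ext x
    refine tendsto_nhds_unique (hU (s + t) x) ?_
    have h1 : Tendsto (fun n => ‖expGroup (B n) t x - U t x‖) atTop (𝓝 0) := by
      simpa using ((hU t x).sub_const (U t x)).norm
    -- The operator and its argument vary together; since the operators are isometries, the error in
    -- the argument is not amplified.
    have h2 : Tendsto (fun n => expGroup (B n) s (expGroup (B n) t x - U t x)) atTop (𝓝 0) :=
      squeeze_zero_norm (fun n => (norm_expGroup_apply (hB n) s _).le) h1
    have h3 := h2.add (hU s (U t x))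
    simpa [expGroup_add] using h3
  have hlip : ∀ x ∈ D, ∀ t, ‖U t x - x‖ ≤ |t| * ‖a x‖ := fun x hx t =>
    le_of_tendsto_of_tendsto ((hU t x).sub_const x).norm ((ha x hx).norm.const_mul |t|)
      (Eventually.of_forall fun n => norm_expGroup_apply_sub_le (hB n) t x)
  have hcD : ∀ x ∈ D, Continuous fun t => U t x := by
    intro x hx
    refine (LipschitzWith.of_dist_le_mul (K := ‖a x‖₊) fun s t => ?_).continuous
    have h := hadd t (s - t)
    rw [add_sub_cancel] at h
    rw [dist_eq_norm, dist_eq_norm, h, ContinuousLinearMap.comp_apply, ← map_sub, hnorm, mul_comm]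
    exact hlip x hx (s - t)
  have hcont : ∀ x, Continuous fun t => U t x := by
    intro x
    -- As every `U t` is an isometry, an orbit is a uniform limit in `t` of orbits starting in `D`,
    -- which are Lipschitz.
    refine continuous_of_uniform_approx_of_continuous fun u hu => ?_
    obtain ⟨ε, hε, hεu⟩ := Metric.mem_uniformity_dist.1 hu
    obtain ⟨y, hy, hyD⟩ := Metric.dense_iff.1 hD x ε hε
    refine ⟨fun t => U t y, hcD y hyD, fun t => hεu ?_⟩
    rw [dist_eq_norm, ← map_sub, hnorm, ← dist_eq_norm, dist_comm]
    exact hy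
  refine ⟨U, ⟨?_, hadd, hcont⟩, hnorm, fun x hx t => ?_⟩
  · ext x
    refine tendsto_nhds_unique (hU 0 x) ?_
    simp [expGroup_zero]
  · refine tendsto_nhds_unique ((hU t x).sub_const x) ?_
    simp only [expGroup_apply_sub_eq_integral]
    obtain ⟨M, hM⟩ := (ha x hx).norm.bddAbove_range
    refine intervalIntegral.tendsto_integral_filter_of_dominated_convergence (fun _ => M)
      (Eventually.of_forall fun n => (continuous_expGroup_apply _ _).aestronglyMeasurable)
      (Eventually.of_forall fun n => Eventually.of_forall fun s _ => ?_)
      intervalIntegrable_const (Eventually.of_forall fun s _ => ?_)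
    · rw [norm_expGroup_apply (hB n)]
      exact hM ⟨n, rfl⟩
    · have h1 : Tendsto (fun n => ‖B n x - a x‖) atTop (𝓝 0) := by
        simpa using ((ha x hx).sub_const (a x)).norm
      have h2 : Tendsto (fun n => expGroup (B n) s (B n x - a x)) atTop (𝓝 0) :=
        squeeze_zero_norm (fun n => (norm_expGroup_apply (hB n) s _).le) h1
      simpa using h2.add (hU s (a x))

end BoundedGroup

/-! ### Resolvents of a skew-adjoint operator and Stone's theorem -/

section SkewAdjoint

variable {𝕜 X : Type*} [RCLike 𝕜] [NormedAddCommGroup X] [InnerProductSpace 𝕜 X]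

local notation "⟪" x ", " y "⟫" => inner 𝕜 x y

/-- A densely defined skew-symmetric operator without a proper skew-symmetric extension by a
vector is skew-adjoint. -/
theorem isSkewAdjoint_of_forall [CompleteSpace X] {A : X →ₗ.[𝕜] X} (hd : Dense (A.domain : Set X))
    (hs : ∀ x y : A.domain, ⟪A x, (y : X)⟫ = -⟪(x : X), A y⟫)
    (hm : ∀ x y : X, (∀ z : A.domain, ⟪y, (z : X)⟫ = -⟪x, A z⟫) → x ∈ A.domain) :
    IsSkewAdjoint A := by
  refine ⟨hd, le_antisymm (And.intro (fun x hx => ?_) ?_) ?_⟩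
  · refine hm x (-(A† ⟨x, hx⟩)) fun z => ?_
    rw [inner_neg_left, LinearPMap.adjoint_isFormalAdjoint hd ⟨x, hx⟩ z]
  · rintro x y hxy
    refine LinearPMap.adjoint_apply_eq hd x fun z => ?_
    rw [LinearPMap.neg_apply, inner_neg_left, hxy]
    exact neg_eq_iff_eq_neg.2 (hs y z)
  · refine LinearPMap.IsFormalAdjoint.le_adjoint hd fun x y => ?_
    rw [LinearPMap.neg_apply, inner_neg_right]
    exact hs x y

namespace IsSkewAdjoint

variable {A : X →ₗ.[𝕜] X}

/-- The operator `1 + εA`, on the domain of `A`. -/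
noncomputable def oneAdd (A : X →ₗ.[𝕜] X) (ε : ℝ) : A.domain →ₗ[𝕜] X :=
  A.domain.subtype + (ε : 𝕜) • A.toFun

theorem oneAdd_apply (ε : ℝ) (x : A.domain) : oneAdd A ε x = (x : X) + (ε : 𝕜) • A x := rfl

variable [CompleteSpace X]

theorem inner_eq_neg (hA : IsSkewAdjoint A) (x y : A.domain) :
    ⟪A x, (y : X)⟫ = -⟪(x : X), A y⟫ := by
  have hx : (x : X) ∈ A†.domain := by rw [hA.2]; exact x.2
  have h := LinearPMap.adjoint_isFormalAdjoint hA.1 ⟨x, hx⟩ y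
  have h2 : A† ⟨x, hx⟩ = -A x :=
    (And.right hA.2.le : ∀ ⦃u : A†.domain⦄ ⦃v : (-A).domain⦄, (u : X) = v → A† u = (-A) v) rfl
  rw [h2, inner_neg_left] at h
  exact neg_eq_iff_eq_neg.1 h

/-- This is the inclusion of `A*` in `-A`, in weak form. It serves to show that `1 + εA` has closed
and dense range, and that the generator is no larger than `A`. -/
theorem exists_apply_eq (hA : IsSkewAdjoint A) {x y : X}
    (h : ∀ z : A.domain, ⟪y, (z : X)⟫ = -⟪x, A z⟫) : ∃ hx : x ∈ A.domain, A ⟨x, hx⟩ = y := by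
  have h' : ∀ z : A.domain, ⟪-y, (z : X)⟫ = ⟪x, A z⟫ := fun z => by
    rw [inner_neg_left, h, neg_neg]
  have hx : x ∈ A†.domain := LinearPMap.mem_adjoint_domain_of_exists x ⟨-y, h'⟩
  have h1 : A† ⟨x, hx⟩ = -y := LinearPMap.adjoint_apply_eq hA.1 _ h'
  have hx' : x ∈ A.domain := by rw [hA.2] at hx; exact hx
  have h2 : A† ⟨x, hx⟩ = -A ⟨x, hx'⟩ :=
    (And.right hA.2.le : ∀ ⦃u : A†.domain⦄ ⦃v : (-A).domain⦄, (u : X) = v → A† u = (-A) v) rfl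
  exact ⟨hx', neg_injective (h2.symm.trans h1)⟩

theorem re_inner_eq_zero (hA : IsSkewAdjoint A) (x : A.domain) :
    RCLike.re ⟪(x : X), A x⟫ = 0 := by
  have h := congrArg RCLike.re (hA.inner_eq_neg x x)
  rw [map_neg, inner_re_symm] at h
  linarith

/-- The cross term is a multiple of `Re ⟪x, A x⟫`, which skew-symmetry makes zero. -/
theorem norm_add_smul_sq (hA : IsSkewAdjoint A) (ε : ℝ) (x : A.domain) :
    ‖(x : X) + (ε : 𝕜) • A x‖ ^ 2 = ‖(x : X)‖ ^ 2 + ε ^ 2 * ‖A x‖ ^ 2 := by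
  rw [norm_add_sq (𝕜 := 𝕜), inner_smul_right, RCLike.re_ofReal_mul, hA.re_inner_eq_zero, norm_smul,
    RCLike.norm_ofReal, mul_pow, sq_abs]
  ring

theorem norm_le_norm_add_smul (hA : IsSkewAdjoint A) (ε : ℝ) (x : A.domain) :
    ‖(x : X)‖ ≤ ‖(x : X) + (ε : 𝕜) • A x‖ := by
  refine le_of_sq_le_sq ?_ (norm_nonneg _)
  rw [hA.norm_add_smul_sq]
  nlinarith [sq_nonneg (ε * ‖A x‖)]

theorem oneAdd_injective (hA : IsSkewAdjoint A) (ε : ℝ) : Function.Injective (oneAdd A ε) := by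
  rw [injective_iff_map_eq_zero]
  intro x hx
  have := hA.norm_le_norm_add_smul ε x
  rw [← oneAdd_apply, hx, norm_zero] at this
  exact Subtype.ext (norm_le_zero_iff.1 this)

/-- Since `1 + εA` does not decrease norms, preimages of a convergent sequence are Cauchy; the weak
description of the graph of `A` passes to the limit. -/
theorem isClosed_range_oneAdd (hA : IsSkewAdjoint A) {ε : ℝ} (hε : ε ≠ 0) :
    IsClosed (LinearMap.range (oneAdd A ε) : Set X) := by
  have hε' : (ε : 𝕜) ≠ 0 := by exact_mod_cast hε
  refine IsSeqClosed.isClosed fun y b hy hb => ?_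
  choose x hx using hy
  have hcau : CauchySeq fun n => (x n : X) := by
    refine (Metric.cauchySeq_iff.2 fun δ hδ => ?_)
    obtain ⟨N, hN⟩ := Metric.cauchySeq_iff.1 hb.cauchySeq δ hδ
    refine ⟨N, fun m hm n hn => lt_of_le_of_lt ?_ (hN m hm n hn)⟩
    rw [dist_eq_norm, dist_eq_norm, ← hx m, ← hx n, ← map_sub]
    exact hA.norm_le_norm_add_smul ε (x m - x n)
  obtain ⟨a, ha⟩ := cauchySeq_tendsto_of_complete hcau
  have hAx : Tendsto (fun n => A (x n)) atTop (𝓝 ((ε : 𝕜)⁻¹ • (b - a))) := by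
    refine ((hb.sub ha).const_smul _).congr fun n => ?_
    rw [← hx n, oneAdd_apply, add_sub_cancel_left, inv_smul_smul₀ hε']
  obtain ⟨haD, hAa⟩ := hA.exists_apply_eq (x := a) (y := (ε : 𝕜)⁻¹ • (b - a)) fun z =>
    tendsto_nhds_unique (hAx.inner tendsto_const_nhds)
      ((ha.inner tendsto_const_nhds).neg.congr fun n => (hA.inner_eq_neg (x n) z).symm)
  exact ⟨⟨a, haD⟩, by rw [oneAdd_apply, hAa, smul_inv_smul₀ hε', add_sub_cancel]⟩

/-- A vector `y` orthogonal to the closed range satisfies `A y = ε⁻¹ y`. Then `y - εA y = 0`,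
against the norm identity unless `y = 0`. -/
theorem oneAdd_surjective (hA : IsSkewAdjoint A) {ε : ℝ} (hε : ε ≠ 0) :
    Function.Surjective (oneAdd A ε) := by
  have hε' : (ε : 𝕜) ≠ 0 := by exact_mod_cast hε
  rw [← LinearMap.range_eq_top]
  have : CompleteSpace (LinearMap.range (oneAdd A ε)) :=
    (hA.isClosed_range_oneAdd hε).completeSpace_coe
  rw [← Submodule.orthogonal_eq_bot_iff, Submodule.eq_bot_iff]
  intro y hy
  rw [Submodule.mem_orthogonal'] at hy
  have h0 : ∀ z : A.domain, ⟪y, (z : X)⟫ + ε * ⟪y, A z⟫ = 0 := fun z => by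
    rw [← inner_smul_right, ← inner_add_right]
    exact hy _ ⟨z, rfl⟩
  obtain ⟨hyD, hAy⟩ := hA.exists_apply_eq (x := y) (y := (ε : 𝕜)⁻¹ • y) fun z => by
    rw [inner_smul_left, map_inv₀, RCLike.conj_ofReal, eq_neg_of_add_eq_zero_left (h0 z)]
    field_simp
  have h1 := hA.norm_add_smul_sq (-ε) ⟨y, hyD⟩
  rw [hAy] at h1
  simp only [RCLike.ofReal_neg, neg_smul, smul_inv_smul₀ hε', add_neg_cancel, norm_zero] at h1
  have h2 : ‖y‖ ^ 2 = 0 := by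
    nlinarith [sq_nonneg ‖y‖, sq_nonneg (ε * ‖(ε : 𝕜)⁻¹ • y‖)]
  exact norm_eq_zero.1 (pow_eq_zero_iff (by norm_num) |>.1 h2)

theorem exists_resolvent (hA : IsSkewAdjoint A) {ε : ℝ} (hε : ε ≠ 0) :
    ∃ J : X →L[𝕜] X, (∀ y, ‖J y‖ ≤ ‖y‖) ∧ (∀ x : A.domain, J (x + (ε : 𝕜) • A x) = x) ∧
      ∀ y, ∃ x : A.domain, J y = x ∧ x + (ε : 𝕜) • A x = y := by
  let e := LinearEquiv.ofBijective (oneAdd A ε) ⟨hA.oneAdd_injective ε, hA.oneAdd_surjective hε⟩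
  have he : ∀ y, (e.symm y : X) + (ε : 𝕜) • A (e.symm y) = y := e.apply_symm_apply
  have hn : ∀ y, ‖(e.symm y : X)‖ ≤ 1 * ‖y‖ := fun y => by
    rw [one_mul]
    exact (hA.norm_le_norm_add_smul ε _).trans_eq (congrArg norm (he y))
  refine ⟨(A.domain.subtype ∘ₗ e.symm.toLinearMap).mkContinuous 1 hn, fun y => ?_, fun x => ?_,
    fun y => ⟨e.symm y, rfl, he y⟩⟩
  · exact (hn y).trans_eq (one_mul _)
  · exact congrArg Subtype.val (e.symm_apply_apply x)

/-- The resolvent `(1 + εA)⁻¹`. -/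
noncomputable def resolvent (hA : IsSkewAdjoint A) {ε : ℝ} (hε : ε ≠ 0) : X →L[𝕜] X :=
  (hA.exists_resolvent hε).choose

theorem norm_resolvent_apply_le (hA : IsSkewAdjoint A) {ε : ℝ} (hε : ε ≠ 0) (y : X) :
    ‖hA.resolvent hε y‖ ≤ ‖y‖ :=
  (hA.exists_resolvent hε).choose_spec.1 y

theorem resolvent_add_smul (hA : IsSkewAdjoint A) {ε : ℝ} (hε : ε ≠ 0) (x : A.domain) :
    hA.resolvent hε (x + (ε : 𝕜) • A x) = x :=
  (hA.exists_resolvent hε).choose_spec.2.1 x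

theorem exists_resolvent_apply (hA : IsSkewAdjoint A) {ε : ℝ} (hε : ε ≠ 0) (y : X) :
    ∃ x : A.domain, hA.resolvent hε y = x ∧ x + (ε : 𝕜) • A x = y :=
  (hA.exists_resolvent hε).choose_spec.2.2 y

theorem resolvent_apply_domain (hA : IsSkewAdjoint A) {ε : ℝ} (hε : ε ≠ 0) (x : A.domain) :
    hA.resolvent hε x = x - (ε : 𝕜) • hA.resolvent hε (A x) := by
  have h := hA.resolvent_add_smul hε x
  rw [map_add, map_smul] at h
  exact eq_sub_of_add_eq h

/-- The adjoint of `(1 + εA)⁻¹` is `(1 - εA)⁻¹`. Keeping `δ` as a variable with an equation allows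
use both from `ε` to `-ε` and from `-ε` to `ε`. -/
theorem inner_resolvent (hA : IsSkewAdjoint A) {ε δ : ℝ} (hε : ε ≠ 0) (hδ : δ ≠ 0)
    (h : δ = -ε) (x y : X) : ⟪hA.resolvent hε x, y⟫ = ⟪x, hA.resolvent hδ y⟫ := by
  subst h
  obtain ⟨u, hu, rfl⟩ := hA.exists_resolvent_apply hε x
  obtain ⟨v, hv, rfl⟩ := hA.exists_resolvent_apply hδ y
  rw [hu, hv, inner_add_left, inner_add_right, inner_smul_left, inner_smul_right,
    hA.inner_eq_neg]
  simp

theorem commute_resolvent (hA : IsSkewAdjoint A) {ε δ : ℝ} (hε : ε ≠ 0) (hδ : δ ≠ 0) :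
    Commute (hA.resolvent hε) (hA.resolvent hδ) := by
  have hε' : (ε : 𝕜) ≠ 0 := by exact_mod_cast hε
  ext y
  obtain ⟨x, hx, rfl⟩ := hA.exists_resolvent_apply hδ y
  obtain ⟨v, hv, hvx⟩ := hA.exists_resolvent_apply hε (x : X)
  -- On `D(A)` the resolvent commutes with `A`.
  have h1 : hA.resolvent hε (A x) = A v := by
    have h2 := hA.resolvent_apply_domain hε x
    rw [hv] at h2
    refine smul_right_injective X hε' ?_
    change (ε : 𝕜) • _ = (ε : 𝕜) • _
    rw [eq_sub_iff_add_eq'.1 h2 |> eq_sub_of_add_eq, ← hvx]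
    simp
  rw [mul_apply_eq_comp, mul_apply_eq_comp, hx, map_add, map_smul, h1, hv, hA.resolvent_add_smul]

/-- On `D(A)` the error is `ε` times the resolvent of `A x`; contractivity extends convergence to
the closure. -/
theorem tendsto_resolvent (hA : IsSkewAdjoint A) {ε : ℕ → ℝ} (hε : ∀ n, ε n ≠ 0)
    (h0 : Tendsto ε atTop (𝓝 0)) (y : X) :
    Tendsto (fun n => hA.resolvent (hε n) y) atTop (𝓝 y) := by
  rw [Metric.tendsto_atTop]
  intro δ hδ
  obtain ⟨x, hx, hxD⟩ := Metric.dense_iff.1 hA.1 y (δ / 3) (by positivity)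
  have hxy : ‖y - x‖ < δ / 3 := by simpa [dist_eq_norm, norm_sub_rev] using hx
  have h1 : Tendsto (fun n => ‖ε n‖ * ‖A ⟨x, hxD⟩‖) atTop (𝓝 0) := by
    simpa using h0.norm.mul_const ‖A ⟨x, hxD⟩‖
  obtain ⟨N, hN⟩ := (h1.eventually_lt_const (show 0 < δ / 3 by positivity)).exists_forall_of_atTop
  refine ⟨N, fun n hn => ?_⟩
  have h2 : ‖hA.resolvent (hε n) x - x‖ ≤ ‖ε n‖ * ‖A ⟨x, hxD⟩‖ := by
    rw [hA.resolvent_apply_domain (hε n) ⟨x, hxD⟩, sub_sub_cancel_left, norm_neg, norm_smul,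
      RCLike.norm_ofReal, Real.norm_eq_abs]
    gcongr
    exact hA.norm_resolvent_apply_le _ _
  have h3 := hA.norm_resolvent_apply_le (hε n) (y - x)
  have h4 := hN n hn
  rw [dist_eq_norm]
  calc ‖hA.resolvent (hε n) y - y‖
      = ‖hA.resolvent (hε n) (y - x) + (hA.resolvent (hε n) x - x) - (y - x)‖ := by
        rw [map_sub]; congr 1; abel
    _ ≤ ‖hA.resolvent (hε n) (y - x)‖ + ‖hA.resolvent (hε n) x - x‖ + ‖y - x‖ :=
        (norm_sub_le _ _).trans (add_le_add (norm_add_le _ _) le_rfl)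
    _ < δ := by linarith

/-- The bounded skew-adjoint approximation `A (1 - ε²A²)⁻¹` of `A`. -/
noncomputable def approx (hA : IsSkewAdjoint A) {ε : ℝ} (hε : ε ≠ 0) : X →L[𝕜] X :=
  ((2 * ε : ℝ) : 𝕜)⁻¹ • (hA.resolvent (neg_ne_zero.2 hε) - hA.resolvent hε)

theorem approx_mem_skewAdjoint (hA : IsSkewAdjoint A) {ε : ℝ} (hε : ε ≠ 0) :
    hA.approx hε ∈ skewAdjoint (X →L[𝕜] X) := by
  rw [skewAdjoint.mem_iff, ContinuousLinearMap.star_eq_adjoint, eq_comm,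
    ContinuousLinearMap.eq_adjoint_iff]
  intro x y
  simp only [approx, neg_apply, smul_apply,
    sub_apply, inner_neg_left, inner_smul_left, inner_smul_right,
    inner_sub_left, inner_sub_right, map_inv₀, RCLike.conj_ofReal]
  rw [hA.inner_resolvent _ hε (neg_neg ε).symm, hA.inner_resolvent hε (neg_ne_zero.2 hε) rfl]
  ring

theorem commute_approx (hA : IsSkewAdjoint A) {ε δ : ℝ} (hε : ε ≠ 0) (hδ : δ ≠ 0) :
    Commute (hA.approx hε) (hA.approx hδ) := by
  refine Commute.smul_left (Commute.smul_right ?_ _) _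
  exact ((hA.commute_resolvent _ _).sub_right (hA.commute_resolvent _ _)).sub_left
    ((hA.commute_resolvent _ _).sub_right (hA.commute_resolvent _ _))

/-- On `D(A)` the factor `ε⁻¹` cancels, leaving a mean of two resolvents at `A x`, each of which
tends to `A x`. -/
theorem approx_apply_domain (hA : IsSkewAdjoint A) {ε : ℝ} (hε : ε ≠ 0) (x : A.domain) :
    hA.approx hε x =
      (2 : 𝕜)⁻¹ • (hA.resolvent (neg_ne_zero.2 hε) (A x) + hA.resolvent hε (A x)) := by
  have hε' : (ε : 𝕜) ≠ 0 := by exact_mod_cast hε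
  simp only [approx, smul_apply, sub_apply]
  rw [hA.resolvent_apply_domain hε, hA.resolvent_apply_domain (neg_ne_zero.2 hε)]
  push_cast
  rw [mul_inv, mul_smul]
  congr 1
  rw [inv_smul_eq_iff₀ hε', smul_add, neg_smul]
  abel

theorem tendsto_approx (hA : IsSkewAdjoint A) {ε : ℕ → ℝ} (hε : ∀ n, ε n ≠ 0)
    (h0 : Tendsto ε atTop (𝓝 0)) (x : A.domain) :
    Tendsto (fun n => hA.approx (hε n) x) atTop (𝓝 (A x)) := by
  simp only [hA.approx_apply_domain]
  have h1 := hA.tendsto_resolvent (fun n => neg_ne_zero.2 (hε n)) (by simpa using h0.neg) (A x)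
  have h2 := (h1.add (hA.tendsto_resolvent hε h0 (A x))).const_smul (2 : 𝕜)⁻¹
  rwa [← two_smul 𝕜 (A x), inv_smul_smul₀ two_ne_zero] at h2

/-- **Stone's theorem**: a skew-adjoint operator generates a group of isometries. -/
theorem exists_isometric_group (hA : IsSkewAdjoint A) :
    ∃ U : ℝ → X →L[𝕜] X, IsC0Group U ∧ IsGenerator A U ∧ ∀ t, Isometry (U t) := by
  let _ : NormedSpace ℝ X := NormedSpace.restrictScalars ℝ 𝕜 X
  have _ : IsScalarTower ℝ 𝕜 X := RestrictScalars.isScalarTower ℝ 𝕜 X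
  classical
  -- The value `0` off `D(A)` only makes the limit a total function.
  let a : X → X := fun x => if hx : x ∈ A.domain then A ⟨x, hx⟩ else 0
  have ha : ∀ x : A.domain, a x = A x := fun x => dif_pos x.2
  have hε : ∀ n : ℕ, 1 / ((n : ℝ) + 1) ≠ 0 := fun n => by positivity
  obtain ⟨U, hU, hn, hi⟩ := exists_isometric_group_of_tendsto
    (B := fun n => hA.approx (hε n)) (fun n => hA.approx_mem_skewAdjoint _)
    (fun m n => hA.commute_approx _ _) hA.1 (a := a) fun x hx => by
      rw [ha ⟨x, hx⟩]
      exact hA.tendsto_approx hε tendsto_one_div_add_atTop_nhds_zero_nat ⟨x, hx⟩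
  have hgen : ∀ x : A.domain,
      Tendsto (fun t : ℝ => ((t⁻¹ : ℝ) : 𝕜) • (U t x - x)) (𝓝[≠] 0) (𝓝 (A x)) := by
    intro x
    have hc := hU.strongly_continuous (A x)
    have hd : HasDerivAt (fun t : ℝ => ∫ s in (0 : ℝ)..t, U s (A x)) (U 0 (A x)) 0 :=
      intervalIntegral.integral_hasDerivAt_right (hc.intervalIntegrable _ _)
        hc.aestronglyMeasurable.stronglyMeasurableAtFilter hc.continuousAt
    rw [hasDerivAt_iff_tendsto_slope, hU.map_zero] at hd
    refine hd.congr fun t => ?_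
    rw [slope_def_module, intervalIntegral.integral_same, sub_zero, sub_zero, hi x x.2 t, ha,
      RCLike.real_smul_eq_coe_smul (K := 𝕜)]
  refine ⟨U, hU, fun x y => ⟨?_, fun h => ?_⟩, fun t => ?_⟩
  · rintro ⟨hx, rfl⟩
    exact hgen ⟨x, hx⟩
  -- If the difference quotient at `x` converges, pairing it with `z ∈ D(A)` and moving `U t` across
  -- as `U (-t)` gives the weak equation `⟪y, z⟫ = -⟪x, A z⟫`.
  · refine hA.exists_apply_eq fun z => ?_
    have hadj : ∀ (t : ℝ) (x z : X), ⟪U t x, z⟫ = ⟪x, U (-t) z⟫ := by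
      intro t x z
      have h1 : z = U t (U (-t) z) := by
        rw [← ContinuousLinearMap.comp_apply, ← hU.map_add, add_neg_cancel, hU.map_zero]; rfl
      conv_lhs => rw [h1]
      exact (LinearIsometry.mk (U t).toLinearMap (hn t)).inner_map_map x (U (-t) z)
    have h1 := h.inner (𝕜 := 𝕜) (tendsto_const_nhds (x := (z : X)))
    have hneg : Tendsto (fun t : ℝ => -t) (𝓝[≠] 0) (𝓝[≠] 0) := by
      refine tendsto_nhdsWithin_iff.2 ⟨?_, ?_⟩
      · have h3 := (continuous_neg (G := ℝ)).tendsto 0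
        rw [neg_zero] at h3
        exact h3.mono_left nhdsWithin_le_nhds
      · filter_upwards [self_mem_nhdsWithin] with t ht
        simpa using ht
    have h2 := (tendsto_const_nhds (x := x)).inner (𝕜 := 𝕜) ((hgen z).comp hneg).neg
    rw [inner_neg_right] at h2
    refine tendsto_nhds_unique h1 (h2.congr fun t => ?_)
    simp only [Function.comp_apply, inner_neg_right, inner_smul_left, inner_smul_right,
      inner_sub_left, inner_sub_right, hadj]
    simp
  · exact AddMonoidHomClass.isometry_of_norm _ (hn t)

end IsSkewAdjoint

end SkewAdjoint

/-! ### Primitives of integrable functions and the product rule -/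

section Primitive

variable {𝕜 : Type*} [RCLike 𝕜]

/-- Integration by parts for two primitives, as an instance of Fubini's theorem. -/
theorem integral_mul_primitive_add {ν : Measure ℝ} [SFinite ν] [NullSingletonClass ν] {g h : ℝ → 𝕜}
    (hg : Integrable g ν) (hh : Integrable h ν) :
    ∫ x, g x * (∫ y in Set.Iic x, h y ∂ν) ∂ν + ∫ x, (∫ y in Set.Iic x, g y ∂ν) * h x ∂ν =
      (∫ x, g x ∂ν) * ∫ x, h x ∂ν := by
  have hgh : Integrable (fun z : ℝ × ℝ => g z.1 * h z.2) (ν.prod ν) := hg.mul_prod hh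
  have hm1 : MeasurableSet {z : ℝ × ℝ | z.2 ≤ z.1} := measurableSet_le measurable_snd measurable_fst
  have hm2 : MeasurableSet {z : ℝ × ℝ | z.1 ≤ z.2} := measurableSet_le measurable_fst measurable_snd
  have h1 : ∫ x, g x * (∫ y in Set.Iic x, h y ∂ν) ∂ν =
      ∫ z, {z : ℝ × ℝ | z.2 ≤ z.1}.indicator (fun z => g z.1 * h z.2) z ∂(ν.prod ν) := by
    rw [integral_prod _ (hgh.indicator hm1)]
    refine integral_congr_ae (Eventually.of_forall fun x => ?_)
    simp only
    rw [← integral_const_mul, ← integral_indicator measurableSet_Iic]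
    rfl
  have h2 : ∫ x, (∫ y in Set.Iic x, g y ∂ν) * h x ∂ν =
      ∫ z, {z : ℝ × ℝ | z.1 ≤ z.2}.indicator (fun z => g z.1 * h z.2) z ∂(ν.prod ν) := by
    rw [integral_prod_symm _ (hgh.indicator hm2)]
    refine integral_congr_ae (Eventually.of_forall fun x => ?_)
    simp only
    rw [← integral_mul_const, ← integral_indicator measurableSet_Iic]
    rfl
  -- The two triangles overlap exactly in the diagonal, which is null because `ν` has no atoms.
  have hdiag : ∀ᵐ z ∂(ν.prod ν), z.1 ≠ z.2 := by
    refine (Measure.ae_prod_iff_ae_ae (p := fun z : ℝ × ℝ => z.1 ≠ z.2) (measurableSet_eq_fun measurable_fst measurable_snd).compl).2 ?_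
    refine Eventually.of_forall fun x => ?_
    filter_upwards [compl_mem_ae_iff.2 (measure_singleton (μ := ν) x)] with y hy
    exact fun h => hy h.symm
  rw [h1, h2, ← integral_add (hgh.indicator hm1) (hgh.indicator hm2), ← integral_prod_mul]
  refine integral_congr_ae ?_
  filter_upwards [hdiag] with z hz
  rcases lt_or_gt_of_ne hz with h | h
  · simp [Set.indicator, h.le, not_le.2 h]
  · simp [Set.indicator, h.le, not_le.2 h]

theorem intervalIntegrable_of_integrableOn_Ioo {E : Type*} [NormedAddCommGroup E] {L : ℝ}
    {g : ℝ → E} (hg : IntegrableOn g (Set.Ioo 0 L)) {x y : ℝ} (hx : x ∈ Set.Icc 0 L)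
    (hy : y ∈ Set.Icc 0 L) : IntervalIntegrable g volume x y := by
  refine IntegrableOn.intervalIntegrable ?_
  rw [← integrableOn_Icc_iff_integrableOn_Ioo] at hg
  exact hg.mono_set (Set.uIcc_subset_Icc hx hy)

/-- `F` is a primitive on `[0,L]` of the integrable function `g`. -/
structure IsPrim (L : ℝ) (F g : ℝ → 𝕜) : Prop where
  integrableOn : IntegrableOn g (Set.Ioo 0 L)
  sub_eq : ∀ x ∈ Set.Icc 0 L, ∀ y ∈ Set.Icc 0 L, F y - F x = ∫ t in x..y, g t

namespace IsPrim

variable {L : ℝ} {F G g h : ℝ → 𝕜}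

theorem intervalIntegrable (hF : IsPrim L F g) {x y : ℝ} (hx : x ∈ Set.Icc 0 L)
    (hy : y ∈ Set.Icc 0 L) : IntervalIntegrable g volume x y :=
  intervalIntegrable_of_integrableOn_Ioo hF.integrableOn hx hy

theorem of_integrableOn (hg : IntegrableOn g (Set.Ioo 0 L)) {a : ℝ} (ha : a ∈ Set.Icc 0 L) :
    IsPrim L (fun x => ∫ t in a..x, g t) g :=
  ⟨hg, fun _ hx _ hy => intervalIntegral.integral_interval_sub_left
    (intervalIntegrable_of_integrableOn_Ioo hg ha hy)
    (intervalIntegrable_of_integrableOn_Ioo hg ha hx)⟩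

theorem of_hasDerivAt (hF : ∀ x, HasDerivAt F (g x) x) (hg : Continuous g) : IsPrim L F g :=
  ⟨(hg.integrableOn_Icc (a := 0) (b := L)).mono_set Set.Ioo_subset_Icc_self, fun x _ y _ =>
    (intervalIntegral.integral_eq_sub_of_hasDerivAt (fun t _ => hF t)
      (hg.intervalIntegrable x y)).symm⟩

theorem const (c : 𝕜) : IsPrim L (fun _ => c) (fun _ => 0) :=
  of_hasDerivAt (fun x => hasDerivAt_const x c) continuous_const

theorem continuousOn (hF : IsPrim L F g) : ContinuousOn F (Set.Icc 0 L) := by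
  rcases le_or_gt 0 L with hL | hL
  · have h1 : ContinuousOn (fun x => ∫ t in (0 : ℝ)..x, g t) (Set.Icc 0 L) := by
      have := intervalIntegral.continuousOn_primitive_interval (μ := volume) (a := 0) (b := L)
        (f := g) (by rw [Set.uIcc_of_le hL, integrableOn_Icc_iff_integrableOn_Ioo]
                     exact hF.integrableOn)
      rwa [Set.uIcc_of_le hL] at this
    refine (h1.add (continuousOn_const (c := F 0))).congr fun x hx => ?_
    simp [← hF.sub_eq 0 ⟨le_rfl, hL⟩ x hx]
  · rw [Set.Icc_eq_empty (not_le.2 hL)]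
    exact continuousOn_empty F

theorem congr (hF : IsPrim L F g) (hgh : g =ᵐ[volume.restrict (Set.Ioo 0 L)] h) :
    IsPrim L F h := by
  refine ⟨hF.integrableOn.congr_fun_ae hgh, fun x hx y hy => ?_⟩
  rw [hF.sub_eq x hx y hy]
  refine intervalIntegral.integral_congr_ae_restrict ?_
  rw [Measure.restrict_congr_set Ioo_ae_eq_Icc] at hgh
  exact ae_restrict_of_ae_restrict_of_subset
    (Set.uIoc_subset_uIcc.trans (Set.uIcc_subset_Icc hx hy)) hgh

theorem add (hF : IsPrim L F g) (hG : IsPrim L G h) : IsPrim L (F + G) (g + h) := by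
  refine ⟨hF.integrableOn.add hG.integrableOn, fun x hx y hy => ?_⟩
  simp only [Pi.add_apply]
  rw [intervalIntegral.integral_add (hF.intervalIntegrable hx hy) (hG.intervalIntegrable hx hy),
    ← hF.sub_eq x hx y hy, ← hG.sub_eq x hx y hy]
  ring

theorem sub (hF : IsPrim L F g) (hG : IsPrim L G h) : IsPrim L (F - G) (g - h) := by
  refine ⟨hF.integrableOn.sub hG.integrableOn, fun x hx y hy => ?_⟩
  simp only [Pi.sub_apply]
  rw [intervalIntegral.integral_sub (hF.intervalIntegrable hx hy) (hG.intervalIntegrable hx hy),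
    ← hF.sub_eq x hx y hy, ← hG.sub_eq x hx y hy]
  ring

theorem const_mul (c : 𝕜) (hF : IsPrim L F g) :
    IsPrim L (fun x => c * F x) (fun x => c * g x) := by
  refine ⟨hF.integrableOn.const_mul c, fun x hx y hy => ?_⟩
  rw [intervalIntegral.integral_const_mul, ← hF.sub_eq x hx y hy]
  ring

theorem conj (hF : IsPrim L F g) :
    IsPrim L (fun x => starRingEnd 𝕜 (F x)) (fun x => starRingEnd 𝕜 (g x)) := by
  refine ⟨(RCLike.conjCLE (K := 𝕜)).toContinuousLinearMap.integrable_comp hF.integrableOn,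
    fun x hx y hy => ?_⟩
  rw [← map_sub, hF.sub_eq x hx y hy]
  simp only [intervalIntegral, integral_conj, map_sub]

/-- On `[x, y]` each factor is its value at `x` plus a primitive; the product of the primitives is
the Fubini identity, and the rest is linear. -/
theorem mul (hF : IsPrim L F g) (hG : IsPrim L G h) :
    IsPrim L (fun x => F x * G x) (fun x => g x * G x + F x * h x) := by
  have hi : IntegrableOn (fun x => g x * G x + F x * h x) (Set.Ioo 0 L) := by
    have h1 := hF.integrableOn
    have h2 := hG.integrableOn
    rw [← integrableOn_Icc_iff_integrableOn_Ioo] at h1 h2 ⊢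
    exact (h1.mul_continuousOn hG.continuousOn isCompact_Icc).add
      (h2.continuousOn_mul hF.continuousOn isCompact_Icc)
  have key : ∀ x ∈ Set.Icc 0 L, ∀ y ∈ Set.Icc 0 L, x ≤ y →
      F y * G y - F x * G x = ∫ t in x..y, (g t * G t + F t * h t) := by
    intro x hx y hy hxy
    have hgi := (hF.intervalIntegrable hx hy).1
    have hhi := (hG.intervalIntegrable hx hy).1
    have hrep : ∀ {K k : ℝ → 𝕜}, IsPrim L K k → ∀ t ∈ Set.Ioc x y,
        K t = K x + ∫ s in Set.Iic t, k s ∂(volume.restrict (Set.Ioc x y)) := by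
      intro K k hK t ht
      have htL : t ∈ Set.Icc 0 L := ⟨hx.1.trans ht.1.le, ht.2.trans hy.2⟩
      rw [Measure.restrict_restrict measurableSet_Iic, Set.inter_comm, Set.Ioc_inter_Iic,
        min_eq_right ht.2, ← intervalIntegral.integral_of_le ht.1.le, ← hK.sub_eq x hx t htL]
      ring
    have e := integral_mul_primitive_add (ν := volume.restrict (Set.Ioc x y)) hgi hhi
    have hgI : ∫ t in Set.Ioc x y, g t = F y - F x := by
      rw [hF.sub_eq x hx y hy, intervalIntegral.integral_of_le hxy]
    have hhI : ∫ t in Set.Ioc x y, h t = G y - G x := by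
      rw [hG.sub_eq x hx y hy, intervalIntegral.integral_of_le hxy]
    have hgG : IntegrableOn (fun t => g t * G t) (Set.Ioc x y) := by
      have h1 := hF.integrableOn
      rw [← integrableOn_Icc_iff_integrableOn_Ioo] at h1
      exact (h1.mul_continuousOn hG.continuousOn isCompact_Icc).mono_set
        (Set.Ioc_subset_Icc_self.trans (Set.Icc_subset_Icc hx.1 hy.2))
    have hFh : IntegrableOn (fun t => F t * h t) (Set.Ioc x y) := by
      have h1 := hG.integrableOn
      rw [← integrableOn_Icc_iff_integrableOn_Ioo] at h1
      exact (h1.continuousOn_mul hF.continuousOn isCompact_Icc).mono_set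
        (Set.Ioc_subset_Icc_self.trans (Set.Icc_subset_Icc hx.1 hy.2))
    have e1 : ∫ t in Set.Ioc x y, g t * G t =
        (∫ t in Set.Ioc x y, g t * (∫ s in Set.Iic t, h s ∂(volume.restrict (Set.Ioc x y)))) +
          (∫ t in Set.Ioc x y, g t) * G x := by
      rw [← integral_mul_const, ← sub_eq_iff_eq_add, ← integral_sub hgG (hgi.mul_const _)]
      refine setIntegral_congr_fun measurableSet_Ioc fun t ht => ?_
      rw [hrep hG t ht]; ring
    have e2 : ∫ t in Set.Ioc x y, F t * h t =
        (∫ t in Set.Ioc x y, (∫ s in Set.Iic t, g s ∂(volume.restrict (Set.Ioc x y))) * h t) +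
          F x * ∫ t in Set.Ioc x y, h t := by
      rw [← integral_const_mul, ← sub_eq_iff_eq_add, ← integral_sub hFh (hhi.const_mul _)]
      refine setIntegral_congr_fun measurableSet_Ioc fun t ht => ?_
      rw [hrep hF t ht]; ring
    rw [intervalIntegral.integral_of_le hxy, integral_add hgG hFh, e1, e2, add_add_add_comm, e,
      hgI, hhI]
    ring
  refine ⟨hi, fun x hx y hy => ?_⟩
  rcases le_total x y with hxy | hxy
  · exact key x hx y hy hxy
  · rw [intervalIntegral.integral_symm, ← key y hy x hx hxy, neg_sub]

theorem setIntegral_eq (hF : IsPrim L F g) (hL : 0 ≤ L) :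
    ∫ x in Set.Ioo 0 L, g x = F L - F 0 := by
  rw [hF.sub_eq 0 ⟨le_rfl, hL⟩ L ⟨hL, le_rfl⟩, intervalIntegral.integral_of_le hL,
    integral_Ioc_eq_integral_Ioo]

end IsPrim

end Primitive

/-! ### Weak derivatives and the du Bois-Reymond lemma -/

section WeakDerivative

variable {𝕜 : Type*} [RCLike 𝕜] {L : ℝ}

theorem IsTest.eq_zero {E : Type*} [NormedAddCommGroup E] [NormedSpace ℝ E] {φ : ℝ → E}
    (hφ : IsTest L φ) {x : ℝ} (hx : x ∉ Set.Ioo 0 L) : φ x = 0 :=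
  image_eq_zero_of_notMem_tsupport fun h => hx (hφ.supp h)

theorem IsTest.deriv {E : Type*} [NormedAddCommGroup E] [NormedSpace ℝ E] {φ : ℝ → E}
    (hφ : IsTest L φ) : IsTest L (deriv φ) :=
  ⟨(contDiff_infty_iff_deriv.1 hφ.smooth).2, hφ.compact.deriv,
    tsupport_deriv_subset.trans hφ.supp⟩

theorem IsTest.ofReal {φ : ℝ → ℝ} (hφ : IsTest L φ) : IsTest L fun x => (φ x : 𝕜) := by
  have hs : Function.support (fun x => (φ x : 𝕜)) = Function.support φ := by
    ext x; simp
  have ht : tsupport (fun x => (φ x : 𝕜)) = tsupport φ := by rw [tsupport, hs, tsupport]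
  exact ⟨(RCLike.ofRealCLM (K := 𝕜)).contDiff.comp hφ.smooth, by rw [HasCompactSupport, ht]; exact hφ.compact,
    ht ▸ hφ.supp⟩

theorem IsTest.hasDerivAt {E : Type*} [NormedAddCommGroup E] [NormedSpace ℝ E] {φ : ℝ → E}
    (hφ : IsTest L φ) (x : ℝ) : HasDerivAt φ (_root_.deriv φ x) x :=
  (hφ.smooth.differentiable (by simp) x).hasDerivAt

theorem IsTest.hasDerivAt_ofReal {φ : ℝ → ℝ} (hφ : IsTest L φ) (x : ℝ) :
    HasDerivAt (fun x => (φ x : 𝕜)) ((_root_.deriv φ x : ℝ) : 𝕜) x :=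
  (RCLike.ofRealCLM (K := 𝕜)).hasFDerivAt.comp_hasDerivAt x (hφ.hasDerivAt x)

theorem IsTest.isPrim {φ : ℝ → 𝕜} (hφ : IsTest L φ) : IsPrim L φ (_root_.deriv φ) :=
  .of_hasDerivAt hφ.hasDerivAt hφ.deriv.smooth.continuous

theorem integrableOn_L2 (f : L2 𝕜 L) : IntegrableOn f (Set.Ioo 0 L) :=
  (Lp.memLp f).integrable (by norm_num)

theorem memLp_of_continuousOn {F : ℝ → 𝕜} (hF : ContinuousOn F (Set.Icc 0 L)) :
    MemLp F 2 (volume.restrict (Set.Ioo 0 L)) := by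
  obtain ⟨C, hC⟩ := isCompact_Icc.exists_bound_of_continuousOn hF
  refine MemLp.of_bound ((hF.mono Set.Ioo_subset_Icc_self).aestronglyMeasurable measurableSet_Ioo) C ?_
  filter_upwards [ae_restrict_mem measurableSet_Ioo] with x hx
  exact hC x (Set.Ioo_subset_Icc_self hx)

theorem isWeakDeriv_one_of_isPrim (hL : 0 ≤ L) {f g : L2 𝕜 L} {F : ℝ → 𝕜}
    (hfF : f =ᵐ[volume.restrict (Set.Ioo 0 L)] F) (hF : IsPrim L F g) : IsWeakDeriv 1 f g := by
  intro φ hφ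
  have hp : IsPrim L (fun x => (φ x : 𝕜)) fun x => ((deriv φ x : ℝ) : 𝕜) :=
    .of_hasDerivAt hφ.hasDerivAt_ofReal (RCLike.continuous_ofReal.comp hφ.deriv.smooth.continuous)
  have h0 := (hp.mul hF).setIntegral_eq hL
  rw [hφ.eq_zero (fun h => lt_irrefl _ h.1), hφ.eq_zero (fun h => lt_irrefl _ h.2)] at h0
  have h1 := hφ.integrable 1 f
  have h2 := hφ.integrable_zero g
  have h3 : ∫ x in Set.Ioo 0 L, (iteratedDeriv 1 φ x • f x + φ x • g x) = 0 := by
    rw [RCLike.ofReal_zero, zero_mul, zero_mul, sub_zero] at h0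
    rw [← h0]
    refine integral_congr_ae ?_
    filter_upwards [hfF] with x hx
    rw [iteratedDeriv_one, hx, RCLike.real_smul_eq_coe_mul, RCLike.real_smul_eq_coe_mul]
  rw [integral_add h1 h2] at h3
  rw [pow_one, neg_smul, one_smul]
  exact eq_neg_of_add_eq_zero_left h3

/-- Zero total integral makes the primitive vanish to the right of the support as well as to the
left, so its support stays in a compact subinterval of `(0,L)`. -/
theorem isTest_primitive {φ : ℝ → ℝ} (hL : 0 < L) (hφ : IsTest L φ) (h0 : ∫ x, φ x = 0) :
    IsTest L fun x => ∫ t in (0 : ℝ)..x, φ t := by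
  have hc := hφ.smooth.continuous
  have hd : ∀ x, HasDerivAt (fun x => ∫ t in (0 : ℝ)..x, φ t) (φ x) x := fun x =>
    intervalIntegral.integral_hasDerivAt_right (hc.intervalIntegrable _ _)
      hc.aestronglyMeasurable.stronglyMeasurableAtFilter hc.continuousAt
  -- Adding `L / 2` makes the set nonempty, so that it has a least and a greatest element even when
  -- `φ = 0`.
  have hK : IsCompact (insert (L / 2) (tsupport φ)) := hφ.compact.isCompact.insert _
  have hKs : insert (L / 2) (tsupport φ) ⊆ Set.Ioo 0 L :=
    Set.insert_subset ⟨by linarith, by linarith⟩ hφ.supp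
  obtain ⟨a, haK, ha⟩ := hK.exists_isLeast ⟨_, Set.mem_insert _ _⟩
  obtain ⟨b, hbK, hb⟩ := hK.exists_isGreatest ⟨_, Set.mem_insert _ _⟩
  have hsup : ∀ x, x ∉ Set.Icc a b → φ x = 0 := fun x hx =>
    image_eq_zero_of_notMem_tsupport fun h =>
      hx ⟨ha (Set.mem_insert_of_mem _ h), hb (Set.mem_insert_of_mem _ h)⟩
  have hi : Integrable φ := hc.integrable_of_hasCompactSupport hφ.compact
  have hz : ∀ x, x ∉ Set.Icc a b → ∫ t in (0 : ℝ)..x, φ t = 0 := by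
    intro x hx
    rw [Set.mem_Icc, not_and_or, not_le, not_le] at hx
    have hleft : ∀ y ≤ a, ∫ t in Set.Iic y, φ t = 0 := fun y hy => by
      rw [← integral_Iic_eq_integral_Iio.symm]
      refine setIntegral_eq_zero_of_forall_eq_zero fun t ht => hsup t fun h => ?_
      exact absurd (h.1) (not_le.2 (lt_of_lt_of_le ht hy))
    rw [← intervalIntegral.integral_Iic_sub_Iic hi.integrableOn hi.integrableOn,
      hleft 0 (hKs haK).1.le, sub_zero]
    rcases hx with hx | hx
    · exact hleft x hx.le
    · rw [← h0, ← intervalIntegral.integral_Iic_add_Ioi hi.integrableOn hi.integrableOn (b := x),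
        left_eq_add]
      exact setIntegral_eq_zero_of_forall_eq_zero fun t ht => hsup t fun h =>
        absurd h.2 (not_le.2 (hx.trans ht))
  have hsub : tsupport (fun x => ∫ t in (0 : ℝ)..x, φ t) ⊆ Set.Icc a b :=
    closure_minimal (fun x hx => by_contra fun h => hx (hz x h)) isClosed_Icc
  refine ⟨contDiff_infty_iff_deriv.2 ⟨fun x => (hd x).differentiableAt, ?_⟩,
    HasCompactSupport.of_support_subset_isCompact isCompact_Icc (subset_closure.trans hsub),
    hsub.trans (Set.Icc_subset_Ioo (hKs haK).1 (hKs hbK).2)⟩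
  rw [funext fun x => (hd x).deriv]
  exact hφ.smooth

theorem exists_isTest_integral_eq_one (hL : 0 < L) : ∃ ρ : ℝ → ℝ, IsTest L ρ ∧ ∫ x, ρ x = 1 := by
  let b : ContDiffBump (L / 2) := ⟨L / 8, L / 4, by positivity, by linarith⟩
  refine ⟨b.normed volume, ⟨b.contDiff_normed, b.hasCompactSupport_normed, ?_⟩, b.integral_normed⟩
  rw [b.tsupport_normed_eq, Real.closedBall_eq_Icc]
  exact Set.Icc_subset_Ioo (by change 0 < L / 2 - L / 4; linarith)
    (by change L / 2 + L / 4 < L; linarith)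

/-- A function whose weak derivative vanishes is constant (du Bois-Reymond). -/
theorem ae_eq_const_of_integral_deriv_smul_eq_zero (hL : 0 < L) {f : ℝ → 𝕜}
    (hf : IntegrableOn f (Set.Ioo 0 L))
    (h : ∀ φ : ℝ → ℝ, IsTest L φ → ∫ x in Set.Ioo 0 L, deriv φ x • f x = 0) :
    ∃ c : 𝕜, f =ᵐ[volume.restrict (Set.Ioo 0 L)] fun _ => c := by
  obtain ⟨ρ, hρ, hρ1⟩ := exists_isTest_integral_eq_one hL
  have hint : ∀ {ψ : ℝ → ℝ}, IsTest L ψ → ∀ {u : ℝ → 𝕜}, IntegrableOn u (Set.Ioo 0 L) →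
      IntegrableOn (fun x => ψ x • u x) (Set.Ioo 0 L) := by
    intro ψ hψ u hu
    obtain ⟨C, hC⟩ := hψ.compact.exists_bound_of_continuous hψ.smooth.continuous
    exact Integrable.bdd_smul hu C hψ.smooth.continuous.aestronglyMeasurable
      (Eventually.of_forall hC)
  refine ⟨∫ x in Set.Ioo 0 L, ρ x • f x, ?_⟩
  set c := ∫ x in Set.Ioo 0 L, ρ x • f x with hc
  have hcont : IntegrableOn (fun _ : ℝ => c) (Set.Ioo 0 L) := integrableOn_const (by simp)
  have key : ∀ᵐ x, x ∈ Set.Ioo 0 L → f x - c = 0 := by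
    refine isOpen_Ioo.ae_eq_zero_of_integral_contDiff_smul_eq_zero
      (hf.sub hcont).locallyIntegrableOn ?_
    intro ψ h1 h2 h3
    have hψ : IsTest L ψ := ⟨h1, h2, h3⟩
    -- Subtracting `(∫ψ)ρ` gives mean zero, hence the derivative of a test function; the hypothesis
    -- then reads `∫ψ f = c ∫ψ`.
    have hψρ : IsTest L (ψ + (-∫ x, ψ x) • ρ) := hψ.add (hρ.smul (𝕜 := ℝ) _)
    have hiψ : Integrable ψ := h1.continuous.integrable_of_hasCompactSupport h2
    have hiρ : Integrable ρ := hρ.smooth.continuous.integrable_of_hasCompactSupport hρ.compact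
    have h4 := h _ (isTest_primitive hL hψρ (by
      simp only [Pi.add_apply, Pi.smul_apply, smul_eq_mul]
      rw [integral_add hiψ (hiρ.const_mul _), integral_const_mul, hρ1]
      simp))
    have hd : ∀ x, deriv (fun x => ∫ t in (0 : ℝ)..x, (ψ + (-∫ x, ψ x) • ρ) t) x
        = (ψ + (-∫ x, ψ x) • ρ) x := fun x =>
      hψρ.smooth.continuous.deriv_integral _ 0 x
    simp only [hd] at h4
    simp only [Pi.add_apply, Pi.smul_apply, add_smul, smul_assoc] at h4
    have hρf : IntegrableOn (fun x => (-∫ x, ψ x) • ρ x • f x) (Set.Ioo 0 L) :=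
      Integrable.smul (-∫ x, ψ x) (hint hρ hf)
    rw [integral_add (hint hψ hf) hρf, integral_smul, ← hc] at h4
    have h5 : ∫ x in Set.Ioo 0 L, ψ x = ∫ x, ψ x :=
      setIntegral_eq_integral_of_forall_compl_eq_zero fun x hx => hψ.eq_zero hx
    rw [← setIntegral_eq_integral_of_forall_compl_eq_zero (s := Set.Ioo 0 L)
      fun x hx => by rw [hψ.eq_zero hx, zero_smul]]
    simp only [smul_sub]
    rw [integral_sub (hint hψ hf) (hint hψ hcont), integral_smul_const, h5, ← h4, neg_smul,
      sub_eq_add_neg]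
  filter_upwards [(ae_restrict_iff' measurableSet_Ioo).2 key] with x hx
  exact sub_eq_zero.1 hx

/-- Subtracting from `f` the primitive of `g` leaves a function with zero weak derivative, which is
constant. -/
theorem IsWeakDeriv.exists_isPrim (hL : 0 < L) {f g : L2 𝕜 L} (h : IsWeakDeriv 1 f g) :
    ∃ F : ℝ → 𝕜, f =ᵐ[volume.restrict (Set.Ioo 0 L)] F ∧ IsPrim L F g := by
  have hp := IsPrim.of_integrableOn (integrableOn_L2 g) (a := 0) ⟨le_rfl, hL.le⟩
  set G : L2 𝕜 L := (memLp_of_continuousOn hp.continuousOn).toLp _ with hG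
  have hGp := MemLp.coeFn_toLp (memLp_of_continuousOn hp.continuousOn)
  have hw := isWeakDeriv_one_of_isPrim hL.le hGp hp
  have hfG : IsWeakDeriv 1 (f - G) 0 := by
    have := h.add (hw.smul (-1))
    simpa [sub_eq_add_neg] using this
  obtain ⟨c, hc⟩ := ae_eq_const_of_integral_deriv_smul_eq_zero hL (integrableOn_L2 (f - G))
    fun φ hφ => by
      have h1 := hfG φ hφ
      rw [iteratedDeriv_one] at h1
      rw [h1]
      have : ∫ x in Set.Ioo 0 L, φ x • (0 : L2 𝕜 L) x = 0 := by
        refine integral_eq_zero_of_ae ?_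
        filter_upwards [Lp.coeFn_zero 𝕜 2 (volume.restrict (Set.Ioo 0 L))] with x hx
        rw [hx]; simp
      rw [this, smul_zero]
  refine ⟨(fun _ => c) + fun x => ∫ t in (0 : ℝ)..x, g t, ?_, ?_⟩
  · filter_upwards [hc, hGp, Lp.coeFn_sub f G] with x h1 h2 h3
    rw [h3, Pi.sub_apply, h2] at h1
    rw [Pi.add_apply, ← h1, sub_add_cancel]
  · refine ((IsPrim.const c).add hp).congr (Eventually.of_forall fun x => ?_)
    simp

/-- The derivative of a test function is again a test function, so the definition of the `n`-th weak
derivative can be applied to it. -/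
theorem IsWeakDeriv.succ_iff {n : ℕ} {f f' g : L2 𝕜 L} (h : IsWeakDeriv n f f') :
    IsWeakDeriv (n + 1) f g ↔ IsWeakDeriv 1 f' g := by
  refine forall₂_congr fun φ hφ => ?_
  rw [iteratedDeriv_succ', h _ hφ.deriv, iteratedDeriv_one, pow_succ, mul_smul]
  exact (smul_right_injective 𝕜 (pow_ne_zero n (by norm_num : (-1 : ℝ) ≠ 0))).eq_iff.trans
    (by rw [pow_one])

theorem IsWeakDeriv.self (f : L2 𝕜 L) : IsWeakDeriv 0 f f := fun φ _ => by simp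

end WeakDerivative

/-! ### Boundary values in `H¹` and `H³`, and the description of `H¹₀` -/

section Sobolev

variable {𝕜 : Type*} [RCLike 𝕜] {L : ℝ}

local notation "⟪" x ", " y "⟫" => inner 𝕜 x y

theorem inner_eq_setIntegral {u v : L2 𝕜 L} {U V : ℝ → 𝕜}
    (hu : u =ᵐ[volume.restrict (Set.Ioo 0 L)] U) (hv : v =ᵐ[volume.restrict (Set.Ioo 0 L)] V) :
    ⟪u, v⟫ = ∫ x in Set.Ioo 0 L, starRingEnd 𝕜 (U x) * V x := by
  rw [L2.inner_def]
  refine integral_congr_ae ?_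
  filter_upwards [hu, hv] with x h1 h2
  rw [h1, h2, RCLike.inner_apply, mul_comm]

theorem inner_add_inner_eq_of_isPrim (hL : 0 ≤ L) {u u' v v' : L2 𝕜 L} {U V : ℝ → 𝕜}
    (hu : u =ᵐ[volume.restrict (Set.Ioo 0 L)] U) (hU : IsPrim L U u')
    (hv : v =ᵐ[volume.restrict (Set.Ioo 0 L)] V) (hV : IsPrim L V v') :
    ⟪u', v⟫ + ⟪u, v'⟫ = starRingEnd 𝕜 (U L) * V L - starRingEnd 𝕜 (U 0) * V 0 := by
  rw [← (hU.conj.mul hV).setIntegral_eq hL, L2.inner_def, L2.inner_def,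
    ← integral_add (L2.integrable_inner u' v) (L2.integrable_inner u v')]
  refine integral_congr_ae ?_
  filter_upwards [hu, hv] with x h1 h2
  rw [h1, h2, RCLike.inner_apply, RCLike.inner_apply]
  ring

/-- The class in `L²(0,L)` of a function that is continuous on `[0,L]`. -/
noncomputable def toL2 {F : ℝ → 𝕜} (hF : ContinuousOn F (Set.Icc 0 L)) : L2 𝕜 L :=
  (memLp_of_continuousOn hF).toLp F

theorem coeFn_toL2 {F : ℝ → 𝕜} (hF : ContinuousOn F (Set.Icc 0 L)) :
    toL2 hF =ᵐ[volume.restrict (Set.Ioo 0 L)] F :=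
  MemLp.coeFn_toLp _

theorem eqOn_Icc_of_ae_eq (hL : 0 < L) {F G : ℝ → 𝕜} (hF : ContinuousOn F (Set.Icc 0 L))
    (hG : ContinuousOn G (Set.Icc 0 L)) (h : F =ᵐ[volume.restrict (Set.Ioo 0 L)] G) :
    Set.EqOn F G (Set.Icc 0 L) := by
  rw [Measure.restrict_congr_set Ioo_ae_eq_Icc] at h
  exact Measure.eqOn_Icc_of_ae_eq volume hL.ne h hF hG

theorem hasTrace_iff (hL : 0 < L) {f : L2 𝕜 L} {F : ℝ → 𝕜}
    (hf : f =ᵐ[volume.restrict (Set.Ioo 0 L)] F) (hF : ContinuousOn F (Set.Icc 0 L)) {a : ℝ}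
    (ha : a ∈ Set.Icc 0 L) {c : 𝕜} : HasTrace f a c ↔ F a = c := by
  refine ⟨?_, fun h => ⟨F, hF, hf, h⟩⟩
  rintro ⟨G, hG, hfG, rfl⟩
  exact eqOn_Icc_of_ae_eq hL hF hG (hf.symm.trans hfG) ha

theorem exists_isPrim_of_mem_sobolevH_three (hL : 0 < L) {f : L2 𝕜 L}
    (hf : f ∈ sobolevH 𝕜 L 3) :
    ∃ F₀ F₁ F₂ : ℝ → 𝕜, f =ᵐ[volume.restrict (Set.Ioo 0 L)] F₀ ∧
      weakDeriv 1 f =ᵐ[volume.restrict (Set.Ioo 0 L)] F₁ ∧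
      IsPrim L F₀ F₁ ∧ IsPrim L F₁ F₂ ∧ IsPrim L F₂ (weakDeriv 3 f) := by
  have h1 := isWeakDeriv_weakDeriv (hf 1 (by norm_num))
  have h2 := isWeakDeriv_weakDeriv (hf 2 (by norm_num))
  have h3 := isWeakDeriv_weakDeriv (hf 3 le_rfl)
  obtain ⟨F₀, e0, p0⟩ := h1.exists_isPrim hL
  obtain ⟨F₁, e1, p1⟩ := (h1.succ_iff.1 h2).exists_isPrim hL
  obtain ⟨F₂, e2, p2⟩ := (h2.succ_iff.1 h3).exists_isPrim hL
  exact ⟨F₀, F₁, F₂, e0, e1, p0.congr e1, p1.congr e2, p2⟩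

theorem isWeakDeriv_of_isPrim (hL : 0 < L) {f g : L2 𝕜 L} {F₀ F₁ F₂ : ℝ → 𝕜}
    (hf : f =ᵐ[volume.restrict (Set.Ioo 0 L)] F₀) (h0 : IsPrim L F₀ F₁) (h1 : IsPrim L F₁ F₂)
    (h2 : IsPrim L F₂ g) :
    IsWeakDeriv 1 f (toL2 h1.continuousOn) ∧ IsWeakDeriv 2 f (toL2 h2.continuousOn) ∧
      IsWeakDeriv 3 f g := by
  have e1 := coeFn_toL2 h1.continuousOn
  have e2 := coeFn_toL2 h2.continuousOn
  have w1 := isWeakDeriv_one_of_isPrim hL.le hf (h0.congr e1.symm)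
  have w2 := w1.succ_iff.2 (isWeakDeriv_one_of_isPrim hL.le e1 (h1.congr e2.symm))
  exact ⟨w1, w2, w2.succ_iff.2 (isWeakDeriv_one_of_isPrim hL.le e2 h2)⟩

theorem mem_sobolevH_three_of_isPrim (hL : 0 < L) {f g : L2 𝕜 L} {F₀ F₁ F₂ : ℝ → 𝕜}
    (hf : f =ᵐ[volume.restrict (Set.Ioo 0 L)] F₀) (h0 : IsPrim L F₀ F₁) (h1 : IsPrim L F₁ F₂)
    (h2 : IsPrim L F₂ g) : f ∈ sobolevH 𝕜 L 3 := by
  obtain ⟨w1, w2, w3⟩ := isWeakDeriv_of_isPrim hL hf h0 h1 h2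
  intro j hj
  interval_cases j
  exacts [⟨_, .self f⟩, ⟨_, w1⟩, ⟨_, w2⟩, ⟨_, w3⟩]

/-- The boundary term in integration by parts is continuous in `H¹` and zero on test functions.
Pairing with `1` gives `F L = F 0`, and pairing with `x` gives `L * F L = 0`. -/
theorem eq_zero_of_isH1LimitOfTest (hL : 0 < L) {f g : L2 𝕜 L} {F : ℝ → 𝕜}
    (hf : f =ᵐ[volume.restrict (Set.Ioo 0 L)] F) (hF : IsPrim L F g)
    (h : IsH1LimitOfTest f) : F 0 = 0 ∧ F L = 0 := by
  obtain ⟨φ, hφ, hlim, hlim'⟩ := h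
  rw [(isWeakDeriv_one_of_isPrim hL.le hf hF).weakDeriv_eq] at hlim'
  let P : ℕ → L2 𝕜 L := fun n => toL2 (L := L) (hφ n).smooth.continuous.continuousOn
  let P' : ℕ → L2 𝕜 L := fun n => toL2 (L := L) (hφ n).deriv.smooth.continuous.continuousOn
  have eP : ∀ n, P n =ᵐ[volume.restrict (Set.Ioo 0 L)] φ n := fun n => coeFn_toL2 _
  have eP' : ∀ n, P' n =ᵐ[volume.restrict (Set.Ioo 0 L)] deriv (φ n) := fun n => coeFn_toL2 _
  have hP : Tendsto P atTop (𝓝 f) := by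
    rw [Lp.tendsto_Lp_iff_tendsto_eLpNorm']
    refine hlim.congr fun n => eLpNorm_congr_ae ?_
    filter_upwards [eP n] with x hx
    simp [hx]
  have hP' : Tendsto P' atTop (𝓝 g) := by
    rw [Lp.tendsto_Lp_iff_tendsto_eLpNorm']
    refine hlim'.congr fun n => eLpNorm_congr_ae ?_
    filter_upwards [eP' n] with x hx
    simp [hx]
  have hφ0 : ∀ n, φ n 0 = 0 := fun n => (hφ n).eq_zero fun h => lt_irrefl _ h.1
  have hφL : ∀ n, φ n L = 0 := fun n => (hφ n).eq_zero fun h => lt_irrefl _ h.2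
  have test : ∀ {u u' : L2 𝕜 L} {U : ℝ → 𝕜}, u =ᵐ[volume.restrict (Set.Ioo 0 L)] U →
      IsPrim L U u' → starRingEnd 𝕜 (U L) * F L - starRingEnd 𝕜 (U 0) * F 0 = 0 := by
    intro u u' U hu hU
    rw [← inner_add_inner_eq_of_isPrim hL.le hu hU hf hF]
    refine tendsto_nhds_unique (((tendsto_const_nhds (x := u')).inner (𝕜 := 𝕜) hP).add
      ((tendsto_const_nhds (x := u)).inner (𝕜 := 𝕜) hP')) (tendsto_const_nhds.congr fun n => ?_)
    rw [inner_add_inner_eq_of_isPrim hL.le hu hU (eP n) ((hφ n).isPrim.congr (eP' n).symm), hφ0,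
      hφL, mul_zero, mul_zero, sub_zero]
  have one := test (coeFn_toL2 (F := fun _ => (1 : 𝕜)) continuousOn_const)
    ((IsPrim.const 1).congr (Lp.coeFn_zero 𝕜 2 (volume.restrict (Set.Ioo 0 L))).symm)
  have hid : IsPrim L (fun x => (x : 𝕜)) (fun _ => (1 : 𝕜)) :=
    .of_hasDerivAt (fun x => by simpa using (RCLike.ofRealCLM (K := 𝕜)).hasDerivAt (x := x))
      continuous_const
  have id := test (coeFn_toL2 hid.continuousOn) (hid.congr (coeFn_toL2 continuousOn_const).symm)
  have hL' : (L : 𝕜) ≠ 0 := by exact_mod_cast hL.ne'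
  have hFL : F L = 0 := by simpa [hL'] using id
  exact ⟨by simpa [hFL] using one, hFL⟩

variable (𝕜 L) in
/-- Poincaré's inequality for functions that vanish at `0`. -/
theorem exists_eLpNorm_le_of_isPrim : ∃ C : ENNReal, C ≠ ⊤ ∧ ∀ {F g : ℝ → 𝕜},
    MemLp g 2 (volume.restrict (Set.Ioo 0 L)) → IsPrim L F g → F 0 = 0 →
    eLpNorm F 2 (volume.restrict (Set.Ioo 0 L)) ≤
      C * eLpNorm g 2 (volume.restrict (Set.Ioo 0 L)) := by
  set m := (volume.restrict (Set.Ioo 0 L)) Set.univ with hm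
  have hmt : m ≠ ⊤ := measure_ne_top _ _
  -- One factor `m ^ (1/2)` is from Hölder, `L¹` against `L²`; the other is from bounding the `L²`
  -- norm by the supremum.
  refine ⟨m ^ (1 / (1 : ENNReal).toReal - 1 / (2 : ENNReal).toReal) * m ^ (2 : ENNReal).toReal⁻¹,
    ENNReal.mul_ne_top (ENNReal.rpow_ne_top_of_nonneg (by norm_num) hmt)
      (ENNReal.rpow_ne_top_of_nonneg (by norm_num) hmt), ?_⟩
  intro F g hg hF h0
  have h1 := eLpNorm_le_eLpNorm_mul_rpow_measure_univ (p := 1) (q := 2) (by norm_num)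
    hg.aestronglyMeasurable
  have h2 : ∀ᵐ x ∂volume.restrict (Set.Ioo 0 L),
      ‖F x‖ₑ ≤ eLpNorm g 1 (volume.restrict (Set.Ioo 0 L)) := by
    filter_upwards [ae_restrict_mem measurableSet_Ioo] with x hx
    have hFx := hF.sub_eq 0 ⟨le_rfl, (hx.1.trans hx.2).le⟩ x (Set.Ioo_subset_Icc_self hx)
    rw [h0, sub_zero, intervalIntegral.integral_of_le hx.1.le] at hFx
    rw [hFx, eLpNorm_one_eq_lintegral_enorm]
    exact (enorm_integral_le_lintegral_enorm _).trans
      (lintegral_mono_set fun t ht => ⟨ht.1, ht.2.trans_lt hx.2⟩)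
  refine (eLpNorm_le_of_ae_enorm_bound h2).trans ?_
  rw [smul_eq_mul]
  refine (mul_le_mul_left h1 _).trans_eq ?_
  rw [← hm]
  ring

/-- Derivatives of test functions form a space `K` whose orthogonal complement consists of
constants. As `∫ g = F L - F 0 = 0`, `g` lies in the closure of `K`, and Poincaré's inequality turns
convergence of derivatives into convergence in `H¹`. -/
theorem isH1LimitOfTest_of_eq_zero (hL : 0 < L) {f g : L2 𝕜 L} {F : ℝ → 𝕜}
    (hf : f =ᵐ[volume.restrict (Set.Ioo 0 L)] F) (hF : IsPrim L F g)
    (h0 : F 0 = 0) (h1 : F L = 0) : IsH1LimitOfTest f := by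
  let K : Submodule 𝕜 (L2 𝕜 L) :=
    { carrier := {h | ∃ φ : ℝ → 𝕜, IsTest L φ ∧ h =ᵐ[volume.restrict (Set.Ioo 0 L)] deriv φ}
      zero_mem' := by
        refine ⟨0, ⟨contDiff_const, HasCompactSupport.zero, by simp [tsupport]⟩, ?_⟩
        rw [Pi.zero_def, deriv_const']
        exact Lp.coeFn_zero _ _ _
      add_mem' := by
        rintro a b ⟨φ, hφ, ea⟩ ⟨ψ, hψ, eb⟩
        refine ⟨φ + ψ, hφ.add hψ, ?_⟩
        filter_upwards [ea, eb, Lp.coeFn_add a b] with x h1 h2 h3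
        rw [h3, Pi.add_apply, h1, h2, deriv_add (hφ.differentiable x) (hψ.differentiable x)]
      smul_mem' := by
        rintro c a ⟨φ, hφ, ea⟩
        refine ⟨c • φ, hφ.smul c, ?_⟩
        filter_upwards [ea, Lp.coeFn_smul c a] with x h1 h2
        rw [h2, Pi.smul_apply, h1, deriv_const_smul c (hφ.differentiable x)] }
  have hg : g ∈ K.topologicalClosure := by
    rw [← Submodule.orthogonal_orthogonal_eq_closure, Submodule.mem_orthogonal]
    intro v hv
    rw [Submodule.mem_orthogonal] at hv
    obtain ⟨c, hc⟩ := ae_eq_const_of_integral_deriv_smul_eq_zero hL (integrableOn_L2 v)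
      fun φ hφ => by
        have ht : IsTest L fun x => (φ x : 𝕜) := hφ.ofReal
        have hu := coeFn_toL2 (L := L) ht.deriv.smooth.continuous.continuousOn
        have h2 := hv _ ⟨_, ht, hu⟩
        rw [inner_eq_setIntegral hu EventuallyEq.rfl] at h2
        rw [← h2]
        refine integral_congr_ae (Eventually.of_forall fun x => ?_)
        have hd : deriv (fun x => (φ x : 𝕜)) x = ((deriv φ x : ℝ) : 𝕜) :=
          HasDerivAt.deriv (F := 𝕜) (hφ.hasDerivAt_ofReal x)
        simp only [hd, RCLike.conj_ofReal, RCLike.real_smul_eq_coe_mul]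
    rw [inner_eq_setIntegral hc EventuallyEq.rfl, integral_const_mul, hF.setIntegral_eq hL.le, h0,
      h1, sub_zero, mul_zero]
  obtain ⟨u, huK, hu⟩ := mem_closure_iff_seq_limit.1 (show g ∈ closure (K : Set (L2 𝕜 L)) from hg)
  choose φ hφ huφ using huK
  rw [Lp.tendsto_Lp_iff_tendsto_eLpNorm'] at hu
  obtain ⟨C, hC, hbound⟩ := exists_eLpNorm_le_of_isPrim 𝕜 L
  refine ⟨φ, hφ, ?_, ?_⟩
  · have hCu : Tendsto (fun n => C * eLpNorm (⇑(u n) - ⇑g) 2 (volume.restrict (Set.Ioo 0 L)))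
        atTop (𝓝 0) := by
      simpa using ENNReal.Tendsto.const_mul hu (Or.inr hC)
    refine tendsto_of_tendsto_of_tendsto_of_le_of_le tendsto_const_nhds hCu
      (fun _ => bot_le) fun n => ?_
    refine le_trans (eLpNorm_congr_ae ?_).le (hbound ((Lp.memLp (u n)).sub (Lp.memLp g))
      (((hφ n).isPrim.congr (huφ n).symm).sub hF) ?_)
    · filter_upwards [hf] with x hx
      rw [hx, Pi.sub_apply]
    · rw [Pi.sub_apply, h0, (hφ n).eq_zero fun h => lt_irrefl _ h.1, sub_zero]
  · rw [(isWeakDeriv_one_of_isPrim hL.le hf hF).weakDeriv_eq]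
    refine hu.congr fun n => eLpNorm_congr_ae ?_
    filter_upwards [huφ n] with x hx
    simp [hx]

theorem mem_sobolevH10_iff (hL : 0 < L) {f g : L2 𝕜 L} {F : ℝ → 𝕜}
    (hf : f =ᵐ[volume.restrict (Set.Ioo 0 L)] F) (hF : IsPrim L F g) :
    f ∈ sobolevH10 𝕜 L ↔ F 0 = 0 ∧ F L = 0 := by
  refine ⟨fun h => eq_zero_of_isH1LimitOfTest hL hf hF h.2, fun h =>
    ⟨fun j hj => ?_, isH1LimitOfTest_of_eq_zero hL hf hF h.1 h.2⟩⟩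
  interval_cases j
  exacts [⟨_, .self f⟩, ⟨_, isWeakDeriv_one_of_isPrim hL.le hf hF⟩]

end Sobolev

/-! ### The expression `f' + f'''` with boundary conditions, and the operator `A` -/

section ThirdOrder

variable {𝕜 : Type*} [RCLike 𝕜] {L : ℝ}

local notation "⟪" x ", " y "⟫" => inner 𝕜 x y

/-- `f` is represented by `F₀`, with successive derivatives `F₁`, `F₂` and `g`. -/
structure IsChain (f g : L2 𝕜 L) (F₀ F₁ F₂ : ℝ → 𝕜) : Prop where
  ae_eq : f =ᵐ[volume.restrict (Set.Ioo 0 L)] F₀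
  isPrim₀ : IsPrim L F₀ F₁
  isPrim₁ : IsPrim L F₁ F₂
  isPrim₂ : IsPrim L F₂ g

/-- The expression `f' + f'''`. -/
noncomputable def derivAdd (f : L2 𝕜 L) : L2 𝕜 L := weakDeriv 1 f + weakDeriv 3 f

/-- The space `{f ∈ H³(0,L) ∩ H¹₀(0,L) : f'(a) = 0}`. -/
def IsDom (a : ℝ) (f : L2 𝕜 L) : Prop :=
  f ∈ sobolevH 𝕜 L 3 ⊓ sobolevH10 𝕜 L ∧ HasTrace (weakDeriv 1 f) a 0

/-- The boundary form of `f ↦ f' + f'''`. -/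
def boundaryForm (U₀ U₁ U₂ V₀ V₁ V₂ : ℝ → 𝕜) (x : ℝ) : 𝕜 :=
  starRingEnd 𝕜 (U₀ x) * V₀ x + starRingEnd 𝕜 (U₂ x) * V₀ x - starRingEnd 𝕜 (U₁ x) * V₁ x +
    starRingEnd 𝕜 (U₀ x) * V₂ x

theorem exists_isChain (hL : 0 < L) {f : L2 𝕜 L} (hf : f ∈ sobolevH 𝕜 L 3) :
    ∃ F₀ F₁ F₂ : ℝ → 𝕜, IsChain f (weakDeriv 3 f) F₀ F₁ F₂ :=
  let ⟨F₀, F₁, F₂, e, _, p0, p1, p2⟩ := exists_isPrim_of_mem_sobolevH_three hL hf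
  ⟨F₀, F₁, F₂, e, p0, p1, p2⟩

namespace IsChain

variable {f g u u₃ v v₃ : L2 𝕜 L} {F₀ F₁ F₂ U₀ U₁ U₂ V₀ V₁ V₂ : ℝ → 𝕜}

theorem weakDeriv_one (h : IsChain f g F₀ F₁ F₂) (hL : 0 < L) :
    weakDeriv 1 f = toL2 h.isPrim₁.continuousOn :=
  (isWeakDeriv_of_isPrim hL h.ae_eq h.isPrim₀ h.isPrim₁ h.isPrim₂).1.weakDeriv_eq

theorem weakDeriv_three (h : IsChain f g F₀ F₁ F₂) (hL : 0 < L) : weakDeriv 3 f = g :=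
  (isWeakDeriv_of_isPrim hL h.ae_eq h.isPrim₀ h.isPrim₁ h.isPrim₂).2.2.weakDeriv_eq

theorem derivAdd_eq (h : IsChain f g F₀ F₁ F₂) (hL : 0 < L) :
    derivAdd f = toL2 h.isPrim₁.continuousOn + g := by
  rw [derivAdd, h.weakDeriv_one hL, h.weakDeriv_three hL]

theorem mem_sobolevH (h : IsChain f g F₀ F₁ F₂) (hL : 0 < L) : f ∈ sobolevH 𝕜 L 3 :=
  mem_sobolevH_three_of_isPrim hL h.ae_eq h.isPrim₀ h.isPrim₁ h.isPrim₂

theorem isDom_iff (h : IsChain f g F₀ F₁ F₂) (hL : 0 < L) {a : ℝ} (ha : a ∈ Set.Icc 0 L) :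
    IsDom a f ↔ F₀ 0 = 0 ∧ F₀ L = 0 ∧ F₁ a = 0 := by
  have e1 := coeFn_toL2 h.isPrim₁.continuousOn
  rw [IsDom, h.weakDeriv_one hL, hasTrace_iff hL e1 h.isPrim₁.continuousOn ha, Submodule.mem_inf,
    mem_sobolevH10_iff hL h.ae_eq (h.isPrim₀.congr e1.symm), and_assoc]
  simp [h.mem_sobolevH hL, and_assoc]

/-- One integration by parts for the first derivative and three, with alternating signs, for the
third. -/
theorem inner_add_inner (hu : IsChain u u₃ U₀ U₁ U₂) (hv : IsChain v v₃ V₀ V₁ V₂) (hL : 0 < L) :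
    ⟪derivAdd u, v⟫ + ⟪u, derivAdd v⟫ =
      boundaryForm U₀ U₁ U₂ V₀ V₁ V₂ L - boundaryForm U₀ U₁ U₂ V₀ V₁ V₂ 0 := by
  have eu1 := coeFn_toL2 hu.isPrim₁.continuousOn
  have eu2 := coeFn_toL2 hu.isPrim₂.continuousOn
  have ev1 := coeFn_toL2 hv.isPrim₁.continuousOn
  have ev2 := coeFn_toL2 hv.isPrim₂.continuousOn
  have pu0 := hu.isPrim₀.congr eu1.symm
  have pu1 := hu.isPrim₁.congr eu2.symm
  have pv0 := hv.isPrim₀.congr ev1.symm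
  have pv1 := hv.isPrim₁.congr ev2.symm
  have i1 := inner_add_inner_eq_of_isPrim hL.le hu.ae_eq pu0 hv.ae_eq pv0
  have i2 := inner_add_inner_eq_of_isPrim hL.le eu2 hu.isPrim₂ hv.ae_eq pv0
  have i3 := inner_add_inner_eq_of_isPrim hL.le eu1 pu1 ev1 pv1
  have i4 := inner_add_inner_eq_of_isPrim hL.le hu.ae_eq pu0 ev2 hv.isPrim₂
  rw [hu.derivAdd_eq hL, hv.derivAdd_eq hL, inner_add_left, inner_add_right]
  simp only [boundaryForm]
  linear_combination i1 + i2 - i3 + i4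

theorem add_smul (hu : IsChain u u₃ U₀ U₁ U₂) (hv : IsChain v v₃ V₀ V₁ V₂) (c : 𝕜) :
    IsChain (u + c • v) (u₃ + c • v₃) (U₀ + fun x => c * V₀ x) (U₁ + fun x => c * V₁ x)
      (U₂ + fun x => c * V₂ x) := by
  have e : ∀ {p q : L2 𝕜 L} {P Q : ℝ → 𝕜}, p =ᵐ[volume.restrict (Set.Ioo 0 L)] P →
      q =ᵐ[volume.restrict (Set.Ioo 0 L)] Q →
      (p + c • q : L2 𝕜 L) =ᵐ[volume.restrict (Set.Ioo 0 L)] P + fun x => c * Q x := by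
    intro p q P Q hp hq
    filter_upwards [hp, hq, Lp.coeFn_add p (c • q), Lp.coeFn_smul c q] with x h1 h2 h3 h4
    rw [h3, Pi.add_apply, h4, Pi.smul_apply, h1, h2, Pi.add_apply, smul_eq_mul]
  exact ⟨e hu.ae_eq hv.ae_eq, hu.isPrim₀.add (hv.isPrim₀.const_mul c),
    hu.isPrim₁.add (hv.isPrim₁.const_mul c),
    (hu.isPrim₂.add (hv.isPrim₂.const_mul c)).congr (e EventuallyEq.rfl EventuallyEq.rfl).symm⟩

end IsChain

/-- A smooth function and its derivatives form a chain. -/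
theorem isChain_of_hasDerivAt {F₀ F₁ F₂ F₃ : ℝ → 𝕜} (h0 : ∀ x, HasDerivAt F₀ (F₁ x) x)
    (h1 : ∀ x, HasDerivAt F₁ (F₂ x) x) (h2 : ∀ x, HasDerivAt F₂ (F₃ x) x) (h3 : Continuous F₃) :
    IsChain (toL2 (L := L) (F := F₀) fun x _ => (h0 x).continuousAt.continuousWithinAt)
      (toL2 h3.continuousOn) F₀ F₁ F₂ :=
  ⟨coeFn_toL2 _, .of_hasDerivAt h0 (continuous_iff_continuousAt.2 fun x => (h1 x).continuousAt),
    .of_hasDerivAt h1 (continuous_iff_continuousAt.2 fun x => (h2 x).continuousAt),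
    (IsPrim.of_hasDerivAt h2 h3).congr (coeFn_toL2 _).symm⟩

theorem hasDerivAt_ofReal_comp {F : ℝ → ℝ} {F' x : ℝ} (h : HasDerivAt F F' x) :
    HasDerivAt (fun x => (F x : 𝕜)) (F' : 𝕜) x :=
  (RCLike.ofRealCLM (K := 𝕜)).hasFDerivAt.comp_hasDerivAt x h

/-- Variation of constants for `f' + f''' = q` with vanishing initial data at `a`. -/
theorem exists_isChain_derivAdd_eq (hL : 0 < L) (q : L2 𝕜 L) {a : ℝ} (ha : a ∈ Set.Icc 0 L) :
    ∃ (f f₃ : L2 𝕜 L) (F₀ F₁ F₂ : ℝ → 𝕜), IsChain f f₃ F₀ F₁ F₂ ∧ derivAdd f = q ∧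
      F₀ a = 0 ∧ F₁ a = 0 ∧ F₂ a = 0 ∧
      ∀ b ∈ Set.Icc 0 L, F₀ b = ∫ t in a..b, ((1 - Real.cos (t - b) : ℝ) : 𝕜) * q t := by
  have hq := integrableOn_L2 q
  have hmul : ∀ {k : ℝ → ℝ}, Continuous k →
      IntegrableOn (fun t => (k t : 𝕜) * q t) (Set.Ioo 0 L) := by
    intro k hk
    have h1 := hq
    rw [← integrableOn_Icc_iff_integrableOn_Ioo] at h1 ⊢
    exact h1.continuousOn_mul (RCLike.continuous_ofReal.comp hk).continuousOn isCompact_Icc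
  have hP := IsPrim.of_integrableOn hq ha
  have hC := IsPrim.of_integrableOn (hmul Real.continuous_cos) ha
  have hS := IsPrim.of_integrableOn (hmul Real.continuous_sin) ha
  have hcos : IsPrim L (fun x => (Real.cos x : 𝕜)) fun x => ((-Real.sin x : ℝ) : 𝕜) :=
    .of_hasDerivAt (fun x => hasDerivAt_ofReal_comp (Real.hasDerivAt_cos x))
      (RCLike.continuous_ofReal.comp Real.continuous_sin.neg)
  have hsin : IsPrim L (fun x => (Real.sin x : 𝕜)) fun x => (Real.cos x : 𝕜) :=
    .of_hasDerivAt (fun x => hasDerivAt_ofReal_comp (Real.hasDerivAt_sin x))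
      (RCLike.continuous_ofReal.comp Real.continuous_cos)
  have hsc : ∀ x, (Real.sin x : 𝕜) ^ 2 + (Real.cos x : 𝕜) ^ 2 = 1 := fun x => by
    exact_mod_cast congrArg (fun r : ℝ => (r : 𝕜)) (Real.sin_sq_add_cos_sq x)
  set P : ℝ → 𝕜 := fun x => ∫ t in a..x, q t with hPdef
  set C : ℝ → 𝕜 := fun x => ∫ t in a..x, (Real.cos t : 𝕜) * q t with hCdef
  set S : ℝ → 𝕜 := fun x => ∫ t in a..x, (Real.sin t : 𝕜) * q t with hSdef
  have h0 := (hP.sub (hcos.mul hC)).sub (hsin.mul hS)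
  have h1 := (hsin.mul hC).sub (hcos.mul hS)
  have h2 := (hcos.mul hC).add (hsin.mul hS)
  -- This is the integral of `(1 - cos(x - t)) q(t)` with the cosine expanded, so that `x` leaves
  -- the integrand and the product rule gives the derivatives.
  set F₀ : ℝ → 𝕜 := (P - fun x => (Real.cos x : 𝕜) * C x) - fun x => (Real.sin x : 𝕜) * S x
    with hF₀
  set F₁ : ℝ → 𝕜 := (fun x => (Real.sin x : 𝕜) * C x) - fun x => (Real.cos x : 𝕜) * S x with hF₁
  set F₂ : ℝ → 𝕜 := (fun x => (Real.cos x : 𝕜) * C x) + fun x => (Real.sin x : 𝕜) * S x with hF₂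
  have p0 : IsPrim L F₀ F₁ := h0.congr (Eventually.of_forall fun x => by
    simp only [hF₁, Pi.sub_apply, RCLike.ofReal_neg]
    linear_combination (-q x) * hsc x)
  have p1 : IsPrim L F₁ F₂ := h1.congr (Eventually.of_forall fun x => by
    simp only [hF₂, Pi.sub_apply, Pi.add_apply, RCLike.ofReal_neg]
    ring)
  have p2 : IsPrim L F₂ (q - toL2 p1.continuousOn : L2 𝕜 L) := h2.congr (by
    filter_upwards [Lp.coeFn_sub q (toL2 p1.continuousOn), coeFn_toL2 p1.continuousOn] with x e1 e2
    rw [e1, Pi.sub_apply, e2]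
    simp only [hF₁, Pi.sub_apply, Pi.add_apply, RCLike.ofReal_neg]
    linear_combination (q x) * hsc x)
  have hchain : IsChain (toL2 p0.continuousOn) (q - toL2 p1.continuousOn) F₀ F₁ F₂ :=
    ⟨coeFn_toL2 _, p0, p1, p2⟩
  refine ⟨_, _, F₀, F₁, F₂, hchain, ?_, ?_, ?_, ?_, fun b hb => ?_⟩
  · rw [hchain.derivAdd_eq hL, add_sub_cancel]
  · simp [hF₀, hPdef, hCdef, hSdef]
  · simp [hF₁, hCdef, hSdef]
  · simp [hF₂, hCdef, hSdef]
  · have iP := hP.intervalIntegrable ha hb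
    have iC := (hC.intervalIntegrable ha hb).const_mul (Real.cos b : 𝕜)
    have iS := (hS.intervalIntegrable ha hb).const_mul (Real.sin b : 𝕜)
    simp only [hF₀, hPdef, hCdef, hSdef, Pi.sub_apply]
    rw [← intervalIntegral.integral_const_mul, ← intervalIntegral.integral_const_mul,
      ← intervalIntegral.integral_sub iP iC, ← intervalIntegral.integral_sub (iP.sub iC) iS]
    refine intervalIntegral.integral_congr fun t _ => ?_
    simp only [Real.cos_sub, RCLike.ofReal_sub, RCLike.ofReal_add, RCLike.ofReal_mul,
      RCLike.ofReal_one]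
    ring

/-- `a` and `b` are the two ends of the interval `[0,L]`. -/
def AreEnds (L a b : ℝ) : Prop := (a = 0 ∧ b = L) ∨ (a = L ∧ b = 0)

namespace AreEnds

variable {a b : ℝ}

theorem symm (h : AreEnds L a b) : AreEnds L b a :=
  h.elim (fun h => .inr ⟨h.2, h.1⟩) fun h => .inl ⟨h.2, h.1⟩

theorem left_mem (h : AreEnds L a b) (hL : 0 < L) : a ∈ Set.Icc 0 L := by
  rcases h with ⟨rfl, _⟩ | ⟨rfl, _⟩
  exacts [⟨le_rfl, hL.le⟩, ⟨hL.le, le_rfl⟩]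

theorem ne (h : AreEnds L a b) (hL : 0 < L) : b - a ≠ 0 := by
  rcases h with ⟨rfl, rfl⟩ | ⟨rfl, rfl⟩
  · rw [sub_zero]; exact hL.ne'
  · rw [zero_sub]; exact neg_ne_zero.2 hL.ne'

theorem forall_iff (h : AreEnds L a b) {p : ℝ → Prop} : p 0 ∧ p L ↔ p a ∧ p b := by
  rcases h with ⟨rfl, rfl⟩ | ⟨rfl, rfl⟩
  exacts [Iff.rfl, and_comm]

theorem sub_eq_zero_iff (h : AreEnds L a b) {B : ℝ → 𝕜} : B L - B 0 = 0 ↔ B b = B a := by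
  rcases h with ⟨rfl, rfl⟩ | ⟨rfl, rfl⟩
  exacts [sub_eq_zero, sub_eq_zero.trans eq_comm]

theorem isDom_iff (h : AreEnds L a b) (hL : 0 < L) {f g : L2 𝕜 L} {F₀ F₁ F₂ : ℝ → 𝕜}
    (hf : IsChain f g F₀ F₁ F₂) : IsDom a f ↔ F₀ a = 0 ∧ F₀ b = 0 ∧ F₁ a = 0 := by
  rw [hf.isDom_iff hL (h.left_mem hL), ← and_assoc, ← and_assoc,
    h.forall_iff (p := fun x => F₀ x = 0)]

/-- With zero values at both ends the boundary form reduces to the product of first derivatives;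
`u'` vanishes at `a` and `v'` at `b`. -/
theorem inner_derivAdd_left (h : AreEnds L a b) (hL : 0 < L) {u v : L2 𝕜 L} (hu : IsDom a u)
    (hv : IsDom b v) : ⟪derivAdd u, v⟫ = -⟪u, derivAdd v⟫ := by
  obtain ⟨U₀, U₁, U₂, cu⟩ := exists_isChain hL hu.1.1
  obtain ⟨V₀, V₁, V₂, cv⟩ := exists_isChain hL hv.1.1
  obtain ⟨u0, u1, u2⟩ := (h.isDom_iff hL cu).1 hu
  obtain ⟨v0, v1, v2⟩ := (h.symm.isDom_iff hL cv).1 hv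
  rw [eq_neg_iff_add_eq_zero, cu.inner_add_inner cv hL, h.sub_eq_zero_iff]
  simp [boundaryForm, u0, u1, u2, v0, v1, v2]

theorem integral_eq_zero (h : AreEnds L a b) (hL : 0 < L) {k : ℝ → 𝕜}
    (hk : ∫ x in Set.Ioo 0 L, k x = 0) : ∫ x in b..a, k x = 0 := by
  rw [← integral_Ioc_eq_integral_Ioo, ← intervalIntegral.integral_of_le hL.le] at hk
  rcases h with ⟨rfl, rfl⟩ | ⟨rfl, rfl⟩
  · rw [intervalIntegral.integral_symm, hk, neg_zero]
  · exact hk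

theorem isDom_of_forall (h : AreEnds L a b) (hL : 0 < L) {θ q : L2 𝕜 L}
    (hθ : ∀ w : L2 𝕜 L, IsDom b w → ⟪derivAdd w, θ⟫ = -⟪w, q⟫) : IsDom a θ := by
  obtain ⟨f, f₃, F₀, F₁, F₂, cf, hfq, f0, f1, f2, -⟩ :=
    exists_isChain_derivAdd_eq hL q (h.left_mem hL)
  have ce : IsChain (𝕜 := 𝕜) (L := L) _ _ (fun x => ((1 - Real.cos (x - a) : ℝ) : 𝕜))
      (fun x => ((Real.sin (x - a) : ℝ) : 𝕜)) (fun x => ((Real.cos (x - a) : ℝ) : 𝕜)) :=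
    isChain_of_hasDerivAt (F₃ := fun x => ((-Real.sin (x - a) : ℝ) : 𝕜))
      (fun x => hasDerivAt_ofReal_comp (by
        simpa using ((hasDerivAt_id x).sub_const a).cos.const_sub 1))
      (fun x => hasDerivAt_ofReal_comp (by
        simpa using ((hasDerivAt_id x).sub_const a).sin))
      (fun x => hasDerivAt_ofReal_comp (by
        simpa using ((hasDerivAt_id x).sub_const a).cos))
      (RCLike.continuous_ofReal.comp (by fun_prop))
  set e : L2 𝕜 L := toL2 (L := L) (F := fun x => ((1 - Real.cos (x - a) : ℝ) : 𝕜))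
    (RCLike.continuous_ofReal.comp (by fun_prop)).continuousOn with he
  have hTe : derivAdd e = 0 := by
    rw [ce.derivAdd_eq hL, Lp.eq_zero_iff_ae_eq_zero]
    refine (Lp.coeFn_add _ _).trans (((coeFn_toL2 _).add (coeFn_toL2 _)).trans
      (Eventually.of_forall fun x => ?_))
    simp
  -- It suffices to be orthogonal to every `g ⟂ e`. Such a `g` is `T w` with zero data at `b`, and
  -- `⟪e, g⟫ = 0` is precisely what makes `w(a) = 0`, hence `w ∈ D_b`.
  have hspan : θ - f ∈ 𝕜 ∙ e := by
    rw [← Submodule.orthogonal_orthogonal (𝕜 ∙ e), Submodule.mem_orthogonal]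
    intro g hg
    rw [Submodule.mem_orthogonal_singleton_iff_inner_right] at hg
    obtain ⟨w, w₃, W₀, W₁, W₂, cw, hwg, w0, w1, w2, hW⟩ :=
      exists_isChain_derivAdd_eq hL g (h.symm.left_mem hL)
    have hWa : W₀ a = 0 := by
      rw [hW a (h.left_mem hL)]
      refine h.integral_eq_zero hL ?_
      rw [← hg, inner_eq_setIntegral (coeFn_toL2 _) EventuallyEq.rfl]
      simp only [RCLike.conj_ofReal]
    have h1 := hθ w ((h.symm.isDom_iff hL cw).2 ⟨w0, hWa, w1⟩)
    have h2 : ⟪derivAdd w, f⟫ + ⟪w, derivAdd f⟫ = 0 := by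
      rw [cw.inner_add_inner cf hL, h.sub_eq_zero_iff]
      simp [boundaryForm, w0, w1, w2, hWa, f0, f1]
    rw [hwg] at h1 h2
    rw [hfq] at h2
    rw [inner_sub_right, h1]
    linear_combination -h2
  obtain ⟨c, hc⟩ := Submodule.mem_span_singleton.1 hspan
  have hθf : θ = f + c • e := by rw [hc, add_sub_cancel]
  have cθ := cf.add_smul ce c
  rw [← hθf] at cθ
  have hTθ : derivAdd θ = q := by
    have mf := cf.mem_sobolevH hL
    have me := Submodule.smul_mem _ c (ce.mem_sobolevH hL)
    have hce : derivAdd (c • e) = c • derivAdd e := by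
      rw [derivAdd, weakDeriv_smul (by norm_num) c (ce.mem_sobolevH hL),
        weakDeriv_smul le_rfl c (ce.mem_sobolevH hL), ← smul_add, derivAdd]
    rw [hθf, derivAdd, weakDeriv_add (by norm_num) mf me, weakDeriv_add le_rfl mf me,
      add_add_add_comm, ← derivAdd, ← derivAdd, hce, hTe, smul_zero, hfq, add_zero]
  -- The cubic `(x - a)(x - b)²` lies in `D_b`, and its second derivative at `b` is `2(b - a) ≠ 0`.
  -- In the boundary form with `θ` only the multiple `2(b - a) θ(b)` remains.
  have cp : IsChain (𝕜 := 𝕜) (L := L) _ _ (fun x => (((x - a) * (x - b) ^ 2 : ℝ) : 𝕜))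
      (fun x => (((x - b) ^ 2 + 2 * (x - a) * (x - b) : ℝ) : 𝕜))
      (fun x => ((4 * (x - b) + 2 * (x - a) : ℝ) : 𝕜)) :=
    isChain_of_hasDerivAt (F₃ := fun x => ((6 : ℝ) : 𝕜))
      (fun x => hasDerivAt_ofReal_comp (by
        have := ((hasDerivAt_id x).sub_const a).mul (((hasDerivAt_id x).sub_const b).pow 2)
        refine this.congr_deriv ?_
        simp; ring))
      (fun x => hasDerivAt_ofReal_comp (by
        have := (((hasDerivAt_id x).sub_const b).pow 2).add
          ((((hasDerivAt_id x).sub_const a).const_mul 2).mul ((hasDerivAt_id x).sub_const b))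
        refine this.congr_deriv ?_
        simp; ring))
      (fun x => hasDerivAt_ofReal_comp (by
        have := (((hasDerivAt_id x).sub_const b).const_mul 4).add
          (((hasDerivAt_id x).sub_const a).const_mul 2)
        refine this.congr_deriv ?_
        norm_num))
      continuous_const
  refine (h.isDom_iff hL cθ).2 ⟨by simp [f0], ?_, by simp [f1]⟩
  have h1 := hθ _ ((h.symm.isDom_iff hL cp).2 ⟨by simp, by simp, by simp⟩)
  have h2 := cp.inner_add_inner cθ hL
  rw [hTθ, h1, neg_add_cancel, eq_comm, h.sub_eq_zero_iff] at h2
  have hne : (b : 𝕜) - a ≠ 0 := by exact_mod_cast h.ne hL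
  simpa [boundaryForm, f0, f1, hne] using h2

end AreEnds

/-- A function orthogonal to the domain vanishes, since the domain contains all test functions. -/
theorem eq_zero_of_forall_isDom (hL : 0 < L) {a b : ℝ} (h : AreEnds L a b) {v : L2 𝕜 L}
    (hv : ∀ w : L2 𝕜 L, IsDom a w → ⟪w, v⟫ = 0) : v = 0 := by
  -- Uniqueness of the weak derivative of order `0` is the fundamental lemma of the calculus of
  -- variations.
  refine (IsWeakDeriv.self v).unique (g' := 0) fun φ hφ => ?_
  have ht : IsTest L fun x => (φ x : 𝕜) := hφ.ofReal
  have ct := isChain_of_hasDerivAt (L := L) ht.hasDerivAt ht.deriv.hasDerivAt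
    ht.deriv.deriv.hasDerivAt ht.deriv.deriv.deriv.smooth.continuous
  have hφ0 : ∀ x, x = a ∨ x = b → x ∉ Set.Ioo 0 L := by
    rintro x hx ⟨h1, h2⟩
    rcases h with ⟨rfl, rfl⟩ | ⟨rfl, rfl⟩ <;> rcases hx with rfl | rfl <;> linarith
  have h1 := hv _ ((h.isDom_iff hL ct).2
    ⟨ht.eq_zero (hφ0 _ (.inl rfl)), ht.eq_zero (hφ0 _ (.inr rfl)),
      ht.deriv.eq_zero (hφ0 _ (.inl rfl))⟩)
  rw [inner_eq_setIntegral ct.ae_eq EventuallyEq.rfl] at h1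
  have h2 : ∫ x in Set.Ioo 0 L, φ x • (0 : L2 𝕜 L) x = 0 := by
    refine integral_eq_zero_of_ae ?_
    filter_upwards [Lp.coeFn_zero 𝕜 2 (volume.restrict (Set.Ioo 0 L))] with x hx
    rw [hx]; simp
  rw [h2, smul_zero, ← h1]
  refine integral_congr_ae (Eventually.of_forall fun x => ?_)
  simp only [iteratedDeriv_zero, RCLike.conj_ofReal, RCLike.real_smul_eq_coe_mul]

theorem isDom_zero (a : ℝ) : IsDom a (0 : L2 𝕜 L) :=
  ⟨zero_mem _, by rw [weakDeriv_zero]; exact HasTrace.zero a⟩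

theorem derivAdd_zero : derivAdd (0 : L2 𝕜 L) = 0 := by
  rw [derivAdd, weakDeriv_zero, weakDeriv_zero, add_zero]

theorem mem_domainA_iff {z : X0 𝕜 L} : z ∈ domainA 𝕜 L ↔ IsDom 0 z.fst ∧ IsDom L z.snd :=
  ⟨fun h => ⟨⟨h.1, h.2.2.1⟩, h.2.1, h.2.2.2⟩, fun h => ⟨h.1.1, h.2.1, h.1.2, h.2.2⟩⟩

theorem inner_X0 (x y : X0 𝕜 L) : ⟪x, y⟫ = ⟪x.fst, y.fst⟫ + ⟪x.snd, y.snd⟫ :=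
  WithLp.prod_inner_apply x y

theorem opA_apply (z : (opA 𝕜 L).domain) :
    opA 𝕜 L z = WithLp.toLp 2 (-derivAdd (z : X0 𝕜 L).snd, -derivAdd (z : X0 𝕜 L).fst) := by
  rw [derivAdd, derivAdd, neg_add', neg_add']
  rfl

theorem isSkewAdjoint_opA (hL : 0 < L) : IsSkewAdjoint (opA 𝕜 L) := by
  have h0 : AreEnds L 0 L := .inl ⟨rfl, rfl⟩
  have hfst : ∀ {w : L2 𝕜 L}, IsDom 0 w → WithLp.toLp 2 (w, 0) ∈ (opA 𝕜 L).domain := fun hw =>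
    mem_domainA_iff.2 ⟨hw, isDom_zero L⟩
  have hsnd : ∀ {w : L2 𝕜 L}, IsDom L w → WithLp.toLp 2 (0, w) ∈ (opA 𝕜 L).domain := fun hw =>
    mem_domainA_iff.2 ⟨isDom_zero 0, hw⟩
  refine isSkewAdjoint_of_forall ?_ (fun x y => ?_) fun x y hxy => ?_
  · rw [Submodule.dense_iff_topologicalClosure_eq_top, Submodule.topologicalClosure_eq_top_iff,
      Submodule.eq_bot_iff]
    intro v hv
    rw [Submodule.mem_orthogonal] at hv
    have h1 : v.fst = 0 := eq_zero_of_forall_isDom hL h0 fun w hw => by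
      simpa [inner_X0] using hv _ (hfst hw)
    have h2 : v.snd = 0 := eq_zero_of_forall_isDom hL h0.symm fun w hw => by
      simpa [inner_X0] using hv _ (hsnd hw)
    exact WithLp.ofLp_injective 2 (Prod.ext h1 h2)
  · obtain ⟨x1, x2⟩ := mem_domainA_iff.1 x.2
    obtain ⟨y1, y2⟩ := mem_domainA_iff.1 y.2
    have e1 := h0.inner_derivAdd_left hL x1 y2
    have e2 := h0.symm.inner_derivAdd_left hL x2 y1
    simp only [opA_apply, inner_X0, WithLp.toLp_fst, WithLp.toLp_snd, inner_neg_left,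
      inner_neg_right]
    linear_combination -e1 - e2
  -- Since `A` swaps components, testing with `(0, w)` constrains the first component of `x`, and
  -- with `(w, 0)` the second.
  · refine mem_domainA_iff.2 ⟨h0.isDom_of_forall hL (q := -y.snd) fun w hw => ?_,
      h0.symm.isDom_of_forall hL (q := -y.fst) fun w hw => ?_⟩
    · have h1 := hxy ⟨_, hsnd hw⟩
      simp only [opA_apply, inner_X0, WithLp.toLp_fst, WithLp.toLp_snd, inner_neg_right,
        derivAdd_zero, neg_zero, inner_zero_right, zero_add, add_zero, neg_neg] at h1
      rw [inner_neg_right, neg_neg, ← inner_conj_symm, ← h1, inner_conj_symm]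
    · have h1 := hxy ⟨_, hfst hw⟩
      simp only [opA_apply, inner_X0, WithLp.toLp_fst, WithLp.toLp_snd, inner_neg_right,
        derivAdd_zero, neg_zero, inner_zero_right, zero_add, add_zero, neg_neg] at h1
      rw [inner_neg_right, neg_neg, ← inner_conj_symm, ← h1, inner_conj_symm]

end ThirdOrder
end Boussinesq

theorem proposition3p1 {𝕜 : Type*} [RCLike 𝕜] (L : ℝ) (hL : 0 < L) :
    Boussinesq.IsSkewAdjoint (Boussinesq.opA 𝕜 L) ∧
      ∃ U : ℝ → Boussinesq.X0 𝕜 L →L[𝕜] Boussinesq.X0 𝕜 L,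
        Boussinesq.IsC0Group U ∧ Boussinesq.IsGenerator (Boussinesq.opA 𝕜 L) U ∧
          ∀ t, Isometry (U t) :=
  ⟨Boussinesq.isSkewAdjoint_opA hL, (Boussinesq.isSkewAdjoint_opA hL).exists_isometric_group⟩
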